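/- Write $\Sigma_k=\{0,1,\dots,k-1\}$. Define morphisms $f:\Sigma_3^*\to\Sigma_2^*$, $g,h:\Sigma_3^*\to\Sigma_3^*$ and $\xi,\eta:\Sigma_2^*\to\Sigma_2^*$ by \begin{align*} &f(0)=0,\ f(1)=01,\ f(2)=011;\qquad g(0)=011,\ g(1)=0121,\ g(2)=012121;\qquad h(0)=01,\ h(1)=02,\ h(2)=022;\\ &\xi(0)=011,\ \xi(1)=01;\qquad \eta(0)=011,\ \eta(1)=1. \end{align*} Morphisms act letter by letter on infinite words as well, and $h^\omega(0)$, $\xi^\omega(0)$ denote the infinite words that begin with $h^n(0)$, respectively $\xi^n(0)$, for every $n\ge 0$. A finite word of length $n$ is rich if it contains exactly $n$ distinct nonempty palindromes as factors (contiguous subwords); an infinite word is rich if all of its finite factors are rich. For an infinite word $w$, let $\mathcal C_w(n)$ be the number of distinct factors of $w$ of length $n$. A word $w\in\Sigma_2^\omega$ is Sturmian if $\mathcal C_w(n)=n+1$ for all $n\ge 0$. It is a complementary symmetric Rote word if its set of factors is closed under exchanging $0$ and $1$ and $\mathcal C_w(n)=2n$ for all $n\ge 1$. For $w=(w_n)_{n\ge0}\in\Sigma_2^\omega$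 let $\Delta(w)=((w_n+w_{n+1})\bmod 2)_{n\ge 0}$. Theorem. (1) The infinite binary words $f(h^\omega(0))$ and $f(g(h^\omega(0)))$ are rich. (2) $\Delta(f(h^\omega(0)))=\xi^\omega(0)$ and $\Delta(f(g(h^\omega(0))))=\eta(\xi^\omega(0))$. (3) The words $\xi^\omega(0)$ and $\eta(\xi^\omega(0))$ are Sturmian. (4) The words $f(h^\omega(0))$ and $f(g(h^\omega(0)))$ are complementary symmetric Rote words. (5) Every complementary symmetric Rote word is rich. -/

import Mathlib

namespace RichWords

/-! ### Finite and infinite words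

A finite word over an alphabet is a list of letters, an infinite word a function on `ℕ`.
The alphabet of size `k` is `Fin k`. -/

section Words

variable {α β : Type*}

/-- The factor of length `n` of the infinite word `w` that starts at position `i`. -/
def factorAt (w : ℕ → α) (i n : ℕ) : List α :=
  (List.range n).map fun j => w (i + j)

/-- The finite word `u` is a factor of the infinite word `w`. -/
def IsFactor (u : List α) (w : ℕ → α) : Prop :=
  ∃ i n : ℕ, u = factorAt w i n

/-- The set of (distinct) nonempty palindromic factors of a finite word. -/
def palindromicFactors (u : List α) : Set (List α) :=
  {p | p ≠ [] ∧ p.Palindrome ∧ p <:+: u}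

theorem finite_palindromicFactors (u : List α) : (palindromicFactors u).Finite := by
  refine (List.finite_toSet u.sublists).subset ?_
  rintro p ⟨-, -, hp⟩
  exact List.mem_sublists.2 hp.sublist

/-- A finite word of length `n` is rich if it contains `n` distinct nonempty palindromes. -/
def Rich (u : List α) : Prop :=
  (palindromicFactors u).ncard = u.length

/-- An infinite word is rich if all of its (finite) factors are rich. -/
def InfRich (w : ℕ → α) : Prop :=
  ∀ u : List α, IsFactor u w → Rich u

/-- The factor complexity of `w`: the number of distinct factors of length `n`. -/
noncomputable def complexity (w : ℕ → α) (n : ℕ) : ℕ :=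
  {u : List α | IsFactor u w ∧ u.length = n}.ncard

/-! ### Morphisms

A morphism is given by the images of the letters. -/

/-- The image of a finite word under the morphism `φ`. -/
def applyMor (φ : α → List β) (u : List α) : List β :=
  u.flatMap φ

/-- The image of an infinite word under a morphism `φ` that erases no letter: its letter at
position `n` is the letter at position `n` of the image of the first `n + 1` letters. -/
def applyInf [Inhabited β] (φ : α → List β) (w : ℕ → α) : ℕ → β :=
  fun n => (applyMor φ (factorAt w 0 (n + 1))).getD n default

/-- The infinite word `φ^ω(a)`, for a morphism `φ` that erases no letter and such that `φ(a)` is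
`a` followed by a nonempty word: its letter at position `n` is that of `φ^n(a)`. -/
def fixedPoint (φ : α → List α) (a : α) : ℕ → α :=
  fun n => ((applyMor φ)^[n] [a]).getD n a

theorem length_factorAt (w : ℕ → α) (i n : ℕ) : (factorAt w i n).length = n := by
  simp [factorAt]

theorem le_length_applyMor {φ : α → List β} (hφ : ∀ a, φ a ≠ []) (u : List α) :
    u.length ≤ (applyMor φ u).length := by
  induction u with
  | nil => simp
  | cons a u ih =>
    have := List.length_pos_iff.2 (hφ a)
    simp only [applyMor, List.flatMap_cons, List.length_append, List.length_cons] at ih ⊢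
    omega

theorem applyMor_mono (φ : α → List β) {u v : List α} (h : u <+: v) :
    applyMor φ u <+: applyMor φ v := by
  obtain ⟨t, rfl⟩ := h
  exact ⟨applyMor φ t, by simp [applyMor]⟩

theorem factorAt_mono (w : ℕ → α) {m n : ℕ} (h : m ≤ n) : factorAt w 0 m <+: factorAt w 0 n := by
  obtain ⟨k, rfl⟩ := Nat.exists_eq_add_of_le h
  simp [factorAt, List.range_add]

theorem getD_eq_of_isPrefix {u v : List α} {n : ℕ} (a b : α) (h : u <+: v) (hn : n < u.length) :
    u.getD n a = v.getD n b := by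
  obtain ⟨t, rfl⟩ := h
  simp [List.getD_eq_getElem?_getD, List.getElem?_append_left hn, hn]

theorem eq_factorAt (w : ℕ → α) (u : List α) (a : α)
    (h : ∀ n < u.length, w n = u.getD n a) : u = factorAt w 0 u.length := by
  refine List.ext_getElem (by simp [factorAt]) fun n h1 h2 => ?_
  have := h n h1
  simp [factorAt, this, h1]

/-- `applyInf φ w` is the infinite word that begins with the images of all the finite words with
which `w` begins. -/
theorem applyInf_spec [Inhabited β] {φ : α → List β} (hφ : ∀ a, φ a ≠ []) (w : ℕ → α) (m : ℕ) :
    applyMor φ (factorAt w 0 m) =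
      factorAt (applyInf φ w) 0 (applyMor φ (factorAt w 0 m)).length := by
  refine eq_factorAt _ _ default fun n hn => ?_
  have hlen : n < (applyMor φ (factorAt w 0 (n + 1))).length := by
    have := le_length_applyMor hφ (factorAt w 0 (n + 1))
    rw [length_factorAt] at this
    omega
  rcases le_total (n + 1) m with h | h
  · exact getD_eq_of_isPrefix _ _ (applyMor_mono φ (factorAt_mono w h)) hlen
  · exact (getD_eq_of_isPrefix _ _ (applyMor_mono φ (factorAt_mono w h)) hn).symm

/-- `fixedPoint φ a` is the infinite word that begins with all the words `φ^m(a)`, whose lengths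
tend to infinity. -/
theorem fixedPoint_spec {φ : α → List α} (hφ : ∀ b, φ b ≠ []) {a : α} {s : List α}
    (ha : φ a = a :: s) (hs : s ≠ []) (m : ℕ) :
    m < ((applyMor φ)^[m] [a]).length ∧
    (applyMor φ)^[m] [a] = factorAt (fixedPoint φ a) 0 ((applyMor φ)^[m] [a]).length := by
  have step : ∀ k, (applyMor φ)^[k] [a] ++ (applyMor φ)^[k] s = (applyMor φ)^[k + 1] [a] := by
    intro k
    have hadd : ∀ u v : List α,
        (applyMor φ)^[k] (u ++ v) = (applyMor φ)^[k] u ++ (applyMor φ)^[k] v := by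
      induction k with
      | zero => simp
      | succ k ih => intro u v; simp [Function.iterate_succ_apply, applyMor, ← ih]
    rw [Function.iterate_succ_apply, show applyMor φ [a] = [a] ++ s by simp [applyMor, ha], hadd]
  have hlens : ∀ k, 0 < ((applyMor φ)^[k] s).length := by
    intro k
    induction k with
    | zero => exact List.length_pos_iff.2 hs
    | succ k ih =>
      rw [Function.iterate_succ_apply']
      exact ih.trans_le (le_length_applyMor hφ _)
  have hlen : ∀ k, k < ((applyMor φ)^[k] [a]).length := by
    intro k
    induction k with
    | zero => simp
    | succ k ih =>
      rw [← step k, List.length_append]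
      have := hlens k
      omega
  have hmono : ∀ j k, j ≤ k → (applyMor φ)^[j] [a] <+: (applyMor φ)^[k] [a] := by
    intro j k hjk
    induction k, hjk using Nat.le_induction with
    | base => exact List.prefix_rfl
    | succ k _ ih => exact ih.trans ⟨_, step k⟩
  refine ⟨hlen m, eq_factorAt _ _ a fun n hn => ?_⟩
  rcases le_total n m with h | h
  · exact getD_eq_of_isPrefix _ _ (hmono n m h) (hlen n)
  · exact (getD_eq_of_isPrefix _ _ (hmono m n h) hn).symm

end Words

/-! ### Sturmian words, complementary symmetric Rote words, first differences -/

/-- A binary infinite word is Sturmian if it has exactly `n + 1` factors of length `n`, for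
every `n`. -/
def IsSturmian (w : ℕ → Fin 2) : Prop :=
  ∀ n : ℕ, complexity w n = n + 1

/-- The complement of a binary word: the letters `0` and `1` are exchanged. -/
def compl (u : List (Fin 2)) : List (Fin 2) :=
  u.map fun a => 1 - a

/-- A complementary symmetric Rote word: a binary infinite word whose set of factors is closed
under complementation and which has `2 * n` factors of length `n`, for every `n ≥ 1`. -/
def IsCSRote (w : ℕ → Fin 2) : Prop :=
  (∀ u : List (Fin 2), IsFactor u w → IsFactor (compl u) w) ∧
    ∀ n : ℕ, 1 ≤ n → complexity w n = 2 * n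

/-- The sequence of first differences modulo 2 (addition in `Fin 2` is modulo 2). -/
def firstDiff (w : ℕ → Fin 2) : ℕ → Fin 2 :=
  fun n => w n + w (n + 1)

/-! ### The morphisms -/

/-- `f(0) = 0`, `f(1) = 01`, `f(2) = 011`. -/
def morF : Fin 3 → List (Fin 2) := ![[0], [0, 1], [0, 1, 1]]

/-- `g(0) = 011`, `g(1) = 0121`, `g(2) = 012121`. -/
def morG : Fin 3 → List (Fin 3) := ![[0, 1, 1], [0, 1, 2, 1], [0, 1, 2, 1, 2, 1]]

/-- `h(0) = 01`, `h(1) = 02`, `h(2) = 022`. -/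
def morH : Fin 3 → List (Fin 3) := ![[0, 1], [0, 2], [0, 2, 2]]

/-- `ξ(0) = 011`, `ξ(1) = 01`. -/
def morXi : Fin 2 → List (Fin 2) := ![[0, 1, 1], [0, 1]]

/-- `η(0) = 011`, `η(1) = 1`. -/
def morEta : Fin 2 → List (Fin 2) := ![[0, 1, 1], [1]]

/-- The word `f(h^ω(0))`. -/
def wordFH : ℕ → Fin 2 := applyInf morF (fixedPoint morH 0)

/-- The word `f(g(h^ω(0)))`. -/
def wordFGH : ℕ → Fin 2 := applyInf morF (applyInf morG (fixedPoint morH 0))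

end RichWords

/-! Everything is reduced to Sturmian words by taking differences modulo 2. Two factors of `w` have
the same differences exactly when they are equal or complementary. So if the factors of `w` are
closed under complementation, right special factors of length `n + 1` of `w` lie two to one over
those of length `n` of `firstDiff w`. As complexity grows by the number of right special factors,
`w` is a complementary symmetric Rote word if and only if `firstDiff w` is Sturmian
(`IsCSRote.isSturmian_firstDiff`, `isCSRote_of_isSturmian_firstDiff`).

Richness follows once every complete return to a palindrome is a palindrome: then each new letter
creates a new palindrome, the longest palindromic suffix (`RoteLike.infRich`). Reversal closure
passes from Sturmian words to Rote words. A palindrome with its forced continuations on both sides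
is a right special palindrome `p`, so only returns to such `p` matter. The right special factors of
that length are `p` and its complement `p'`. One letter after `p` leads straight back to `p`, the
other to `p'`, and complementarily at `p'`. A return thus either is this loop, or goes to `p'`,
loops there and comes back; its length determines it, so it equals its reversal
(`Pivot.palAt_return`).

For the concrete words, `morA` records the differences of the blocks of `morF` and intertwines
`morH` with `morXi`, and `morG` with the composite of `morEta` and `morXi`. Both `morXi` and
`morEta` are products of the elementary Sturmian morphisms `morD` and `morFib`; desubstituting right
special factors shows that the difference words are Sturmian. A parity count of the letters `1`
gives closure under complementation. -/

namespace RichWords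

/-! ### Occurrences of factors, right special factors and aperiodicity. -/

section Basic

variable {α : Type*}

theorem fin_two_eq_of_ne {a b c : Fin 2} (h : a ≠ b) (h' : a ≠ c) : b = c := by
  revert a b c; decide

/-- The factors of length `n` at the positions `i` and `j` are equal. -/
def SameAt (w : ℕ → α) (i j n : ℕ) : Prop := ∀ t < n, w (i + t) = w (j + t)

/-- The factors of length `n` at the positions `i` and `j` differ in every letter. -/
def OppAt (w : ℕ → α) (i j n : ℕ) : Prop := ∀ t < n, w (i + t) ≠ w (j + t)

/-- The factors of length `n` at the positions `i` and `j` are the reversals of each other. -/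
def MirrorAt (w : ℕ → α) (i j n : ℕ) : Prop := ∀ t < n, w (j + t) = w (i + (n - 1 - t))

/-- The factor of length `n` at the position `i` is right special. -/
def BranchAt (w : ℕ → α) (i n : ℕ) : Prop := ∃ j, SameAt w i j n ∧ w (i + n) ≠ w (j + n)

/-- No two distinct suffixes of `w` are equal. -/
def Aperiodic (w : ℕ → α) : Prop := ∀ s t, s < t → ∃ j, w (s + j) ≠ w (t + j)

/-- Each letter can follow the factor `v` of `w`. -/
def RightSpecial (w : ℕ → α) (v : List α) : Prop := ∀ a, IsFactor (v ++ [a]) w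

variable {w : ℕ → α} {i j k m n : ℕ}

theorem SameAt.symm (h : SameAt w i j n) : SameAt w j i n := fun t ht => (h t ht).symm

theorem SameAt.trans (h : SameAt w i j n) (h' : SameAt w j k n) : SameAt w i k n :=
  fun t ht => (h t ht).trans (h' t ht)

theorem SameAt.mono (h : SameAt w i j n) (hmn : m ≤ n) : SameAt w i j m :=
  fun t ht => h t (by omega)

theorem SameAt.shift (h : SameAt w i j n) (hmn : k + m ≤ n) : SameAt w (i + k) (j + k) m :=
  fun t ht => by simpa [add_assoc] using h (k + t) (by omega)

theorem SameAt.succ (h : SameAt w i j n) (h' : w (i + n) = w (j + n)) : SameAt w i j (n + 1) := by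
  intro t ht
  rcases Nat.lt_succ_iff_lt_or_eq.1 ht with ht | rfl
  exacts [h t ht, h']

theorem BranchAt.shift (h : BranchAt w i n) (hmn : k + m = n) : BranchAt w (i + k) m := by
  obtain ⟨j, hj, hne⟩ := h
  subst hmn
  exact ⟨j + k, hj.shift le_rfl, by simpa [add_assoc] using hne⟩

theorem BranchAt.of_sameAt (h : BranchAt w i n) (hs : SameAt w i j n) : BranchAt w j n := by
  obtain ⟨k, hk, hne⟩ := h
  by_cases hij : w (i + n) = w (j + n)
  · exact ⟨k, hs.symm.trans hk, hij ▸ hne⟩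
  · exact ⟨i, hs.symm, Ne.symm hij⟩

theorem eq_of_not_branchAt (h : ¬ BranchAt w i n) (hs : SameAt w i j n) :
    w (i + n) = w (j + n) := by
  by_contra hne
  exact h ⟨j, hs, hne⟩

theorem factorAt_eq_factorAt_iff {w' : ℕ → α} :
    factorAt w i n = factorAt w' j n ↔ ∀ t < n, w (i + t) = w' (j + t) := by
  simp [factorAt]

theorem factorAt_succ (w : ℕ → α) (i n : ℕ) :
    factorAt w i (n + 1) = factorAt w i n ++ [w (i + n)] := by
  simp [factorAt, List.range_succ]

theorem factorAt_add (w : ℕ → α) (i m n : ℕ) :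
    factorAt w i (m + n) = factorAt w i m ++ factorAt w (i + m) n := by
  simp [factorAt, List.range_add, add_assoc, Function.comp_def]

theorem isFactor_factorAt (w : ℕ → α) (i n : ℕ) : IsFactor (factorAt w i n) w := ⟨i, n, rfl⟩

theorem isFactor_iff_exists_eq {v : List α} :
    IsFactor v w ↔ ∃ i, v = factorAt w i v.length := by
  constructor
  · rintro ⟨i, n, rfl⟩
    exact ⟨i, by rw [length_factorAt]⟩
  · rintro ⟨i, h⟩
    exact ⟨i, _, h⟩

theorem isFactor_append_singleton {v : List α} {a : α} :
    IsFactor (v ++ [a]) w ↔ ∃ i, v = factorAt w i v.length ∧ a = w (i + v.length) := by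
  rw [isFactor_iff_exists_eq]
  refine exists_congr fun i => ?_
  rw [List.length_append, List.length_singleton, factorAt_succ]
  refine ⟨fun h => by simpa using List.append_inj' h rfl, ?_⟩
  rintro ⟨h, rfl⟩
  rw [← h]

theorem setOf_isFactor_eq_range (w : ℕ → α) (n : ℕ) :
    {u : List α | IsFactor u w ∧ u.length = n} = Set.range fun i => factorAt w i n := by
  ext u
  simp only [Set.mem_ofPred_eq, Set.mem_range]
  constructor
  · rintro ⟨⟨i, m, rfl⟩, h⟩
    rw [length_factorAt] at h
    exact ⟨i, by rw [h]⟩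
  · rintro ⟨i, rfl⟩
    exact ⟨isFactor_factorAt _ _ _, length_factorAt _ _ _⟩

theorem finite_setOf_isFactor [Finite α] (w : ℕ → α) (n : ℕ) :
    {u : List α | IsFactor u w ∧ u.length = n}.Finite :=
  (List.finite_length_eq α n).subset fun _ h => h.2

/-- If the factors of length `n` at two positions agree, one of the factors of length `n` between
them is right special. -/
theorem Aperiodic.exists_branchAt (hw : Aperiodic w) {s t : ℕ} (hst : s < t)
    (h : SameAt w s t n) : ∃ r, s ≤ r ∧ r < t ∧ BranchAt w r n := by
  by_contra! hb
  -- Without branching the agreement propagates one letter at a time; a position beyond `t` carries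
  -- the same factor as the one `t - s` earlier. Two suffixes of `w` would then coincide.
  have key : ∀ j, SameAt w (s + j) (t + j) n ∧ ¬ BranchAt w (s + j) n := by
    intro j
    induction j using Nat.strong_induction_on with
    | _ j ih =>
      have h1 : SameAt w (s + j) (t + j) n := by
        rcases j with _ | j
        · exact h
        · obtain ⟨h2, h3⟩ := ih j (by omega)
          have := (h2.succ (eq_of_not_branchAt h3 h2)).shift (k := 1) (m := n) (by omega)
          simpa [add_assoc] using this
      refine ⟨h1, ?_⟩
      by_cases hj : s + j < t
      · exact hb _ (by omega) hj
      · obtain ⟨h2, h3⟩ := ih (j - (t - s)) (by omega)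
        rw [show t + (j - (t - s)) = s + j by omega] at h2
        exact fun h4 => h3 (h4.of_sameAt h2.symm)
  obtain ⟨j, hj⟩ := hw (s + n) (t + n) (by omega)
  obtain ⟨h2, h3⟩ := key j
  have := eq_of_not_branchAt h3 h2
  exact hj (by convert this using 2 <;> omega)

/-- The factors that contain no right special factor of length `n` are of bounded length. -/
theorem Aperiodic.exists_branchAt_bounded [Finite α] (hw : Aperiodic w) (n : ℕ) :
    ∃ K, ∀ s, ∃ i, s ≤ i ∧ i ≤ s + K ∧ BranchAt w i n := by
  have := Fintype.ofFinite α
  classical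
  -- Among more consecutive positions than there are words of length `n`, two carry the same factor.
  refine ⟨Fintype.card (Fin n → α) + 1, fun s => ?_⟩
  obtain ⟨x, y, hne, hxy⟩ := Fintype.exists_ne_map_eq_of_card_lt
    (fun (x : Fin (Fintype.card (Fin n → α) + 1)) (t : Fin n) => w (s + x + t)) (by simp)
  have h : SameAt w (s + x) (s + y) n := fun t ht => congrFun hxy ⟨t, ht⟩
  have hx := x.2
  have hy := y.2
  rcases lt_or_gt_of_ne (Fin.val_ne_of_ne hne) with hlt | hlt
  · obtain ⟨r, h1, h2, hb⟩ := hw.exists_branchAt (by omega) h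
    exact ⟨r, by omega, by omega, hb⟩
  · obtain ⟨r, h1, h2, hb⟩ := hw.exists_branchAt (by omega) h.symm
    exact ⟨r, by omega, by omega, hb⟩

/-- There are arbitrarily far right special factors of each length. -/
theorem Aperiodic.exists_branchAt_ge [Finite α] (hw : Aperiodic w) (s n : ℕ) :
    ∃ i, s ≤ i ∧ BranchAt w i n := by
  obtain ⟨K, hK⟩ := hw.exists_branchAt_bounded n
  obtain ⟨i, h1, -, h2⟩ := hK s
  exact ⟨i, h1, h2⟩

/-- If the suffixes at `s < t` coincide, any position from `t` on can be moved back by `t - s`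
without changing its factor, so there are at most `t` factors of each length. -/
theorem aperiodic_of_complexity [Finite α] (h : ∀ n, ∃ m, n < complexity w m) : Aperiodic w := by
  intro s t hst
  by_contra! hp
  obtain ⟨m, hm⟩ := h t
  have hsub : {u : List α | IsFactor u w ∧ u.length = m} ⊆
      (fun i => factorAt w i m) '' (Finset.range t : Set ℕ) := by
    rw [setOf_isFactor_eq_range]
    rintro _ ⟨i, rfl⟩
    induction i using Nat.strong_induction_on with
    | _ i ih =>
      by_cases hi : i < t
      · exact ⟨i, by simpa using hi, rfl⟩
      · obtain ⟨j, hj, h2⟩ := ih (i - (t - s)) (by omega)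
        refine ⟨j, hj, h2.trans ?_⟩
        refine factorAt_eq_factorAt_iff.2 fun r _ => ?_
        have := hp (i - t + r)
        convert this using 2 <;> omega
  have h1 := Set.ncard_le_ncard hsub (Set.toFinite _)
  have h2 := Set.ncard_image_le (f := fun i => factorAt w i m) (Finset.range t).finite_toSet
  rw [Set.ncard_coe_finset, Finset.card_range] at h2
  exact absurd hm (not_lt.2 (h1.trans h2))

theorem complexity_zero (w : ℕ → α) : complexity w 0 = 1 := by
  rw [complexity, setOf_isFactor_eq_range, Set.ncard_eq_one]
  exact ⟨[], by simp [factorAt, Set.range_const]⟩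

end Basic

/-! ### Complexity of binary words and right special factors. -/

section Binary

variable {w : ℕ → Fin 2} {i j k m n : ℕ}

theorem rightSpecial_factorAt_iff : RightSpecial w (factorAt w i n) ↔ BranchAt w i n := by
  simp only [RightSpecial, isFactor_append_singleton, length_factorAt, factorAt_eq_factorAt_iff]
  constructor
  · intro h
    obtain ⟨j, hj, h1⟩ := h (1 - w (i + n))
    refine ⟨j, hj, ?_⟩
    rw [← h1]
    generalize w (i + n) = a
    revert a; decide
  · rintro ⟨j, hj, hne⟩ a
    by_cases ha : a = w (i + n)
    · exact ⟨i, fun _ _ => rfl, ha⟩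
    · exact ⟨j, hj, fin_two_eq_of_ne (Ne.symm ha) hne⟩

theorem RightSpecial.isFactor {v : List (Fin 2)} (h : RightSpecial w v) : IsFactor v w := by
  obtain ⟨i, h1, -⟩ := isFactor_append_singleton.1 (h 0)
  exact ⟨i, _, h1⟩

theorem RightSpecial.exists_eq {v : List (Fin 2)} (h : RightSpecial w v) :
    ∃ i, v = factorAt w i v.length ∧ BranchAt w i v.length := by
  obtain ⟨i, h1⟩ := isFactor_iff_exists_eq.1 h.isFactor
  exact ⟨i, h1, rightSpecial_factorAt_iff.1 (h1 ▸ h)⟩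

theorem finite_setOf_rightSpecial (w : ℕ → Fin 2) (n : ℕ) :
    {v : List (Fin 2) | v.length = n ∧ RightSpecial w v}.Finite :=
  (List.finite_length_eq (Fin 2) n).subset fun _ h => h.1

/-- Let `A a` be the words of length `n` that `a` can follow. Every factor can be prolonged, so the
union of `A 0` and `A 1` is the set of factors and the intersection that of right special ones; the
formula is inclusion-exclusion. -/
theorem complexity_succ (w : ℕ → Fin 2) (n : ℕ) :
    complexity w (n + 1) =
      complexity w n + {v : List (Fin 2) | v.length = n ∧ RightSpecial w v}.ncard := by
  let A (a : Fin 2) : Set (List (Fin 2)) := {v | v.length = n ∧ IsFactor (v ++ [a]) w}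
  have hfin (a : Fin 2) : (A a).Finite := (List.finite_length_eq (Fin 2) n).subset fun _ h => h.1
  have hU : {u : List (Fin 2) | IsFactor u w ∧ u.length = n} = A 0 ∪ A 1 := by
    ext u
    simp only [A, Set.mem_ofPred_eq, Set.mem_union]
    constructor
    · rintro ⟨h, rfl⟩
      obtain ⟨i, h1⟩ := isFactor_iff_exists_eq.1 h
      have h2 : IsFactor (u ++ [w (i + u.length)]) w := isFactor_append_singleton.2 ⟨i, h1, rfl⟩
      generalize w (i + u.length) = a at h2
      fin_cases a
      exacts [Or.inl ⟨rfl, h2⟩, Or.inr ⟨rfl, h2⟩]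
    · rintro (⟨h, h1⟩ | ⟨h, h1⟩) <;>
      · obtain ⟨i, h2, -⟩ := isFactor_append_singleton.1 h1
        exact ⟨⟨i, _, h2⟩, h⟩
  have hI : {v : List (Fin 2) | v.length = n ∧ RightSpecial w v} = A 0 ∩ A 1 := by
    ext u
    simp only [A, RightSpecial, Fin.forall_fin_two, Set.mem_ofPred_eq, Set.mem_inter_iff]
    tauto
  have hS : {u : List (Fin 2) | IsFactor u w ∧ u.length = n + 1} =
      (· ++ [0]) '' A 0 ∪ (· ++ [1]) '' A 1 := by
    ext u
    simp only [A, Set.mem_ofPred_eq, Set.mem_union, Set.mem_image]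
    constructor
    · rintro ⟨h, h1⟩
      have hne : u ≠ [] := by rintro rfl; simp at h1
      have h2 : u.dropLast ++ [u.getLast hne] = u := List.dropLast_append_getLast hne
      have h3 : u.dropLast.length = n := by simp [h1]
      generalize u.getLast hne = a at h2
      generalize u.dropLast = v at h2 h3
      subst h2
      fin_cases a
      exacts [Or.inl ⟨v, ⟨h3, h⟩, rfl⟩, Or.inr ⟨v, ⟨h3, h⟩, rfl⟩]
    · rintro (⟨v, ⟨h, h1⟩, rfl⟩ | ⟨v, ⟨h, h1⟩, rfl⟩) <;> exact ⟨h1, by simp [h]⟩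
  have hdisj : Disjoint ((· ++ [(0 : Fin 2)]) '' A 0) ((· ++ [(1 : Fin 2)]) '' A 1) := by
    rw [Set.disjoint_left]
    rintro _ ⟨v, -, rfl⟩ ⟨v', -, h⟩
    have := congrArg List.getLast? h
    simp at this
  rw [complexity, complexity, hU, hI, hS, Set.ncard_union_eq hdisj ((hfin 0).image _)
    ((hfin 1).image _), Set.ncard_image_of_injective _ (List.append_left_injective _),
    Set.ncard_image_of_injective _ (List.append_left_injective _),
    Set.ncard_union_add_ncard_inter _ _ (hfin 0) (hfin 1)]

theorem IsSturmian.aperiodic (h : IsSturmian w) : Aperiodic w :=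
  aperiodic_of_complexity fun n => ⟨n, by rw [h n]; omega⟩

theorem ncard_rightSpecial_of_isSturmian (h : IsSturmian w) (n : ℕ) :
    {v : List (Fin 2) | v.length = n ∧ RightSpecial w v}.ncard = 1 := by
  have := complexity_succ w n
  rw [h, h] at this
  omega

/-- A Sturmian word has at most one right special factor of each length. -/
theorem IsSturmian.sameAt (h : IsSturmian w) (hi : BranchAt w i n) (hj : BranchAt w j n) :
    SameAt w i j n := by
  obtain ⟨v, hv⟩ := Set.ncard_eq_one.1 (ncard_rightSpecial_of_isSturmian h n)
  have key : ∀ k, BranchAt w k n → factorAt w k n = v := fun k hk => by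
    have : factorAt w k n ∈ {v : List (Fin 2) | v.length = n ∧ RightSpecial w v} :=
      ⟨length_factorAt _ _ _, rightSpecial_factorAt_iff.2 hk⟩
    rwa [hv] at this
  exact factorAt_eq_factorAt_iff.1 ((key i hi).trans (key j hj).symm)

theorem isSturmian_of_existsUnique
    (h : ∀ n, ∃! v : List (Fin 2), v.length = n ∧ RightSpecial w v) : IsSturmian w := by
  intro n
  induction n with
  | zero => exact complexity_zero w
  | succ n ih =>
    rw [complexity_succ, ih, Set.ncard_eq_one.2]
    obtain ⟨v, hv, hu⟩ := h n
    exact ⟨v, Set.eq_singleton_iff_unique_mem.2 ⟨hv, hu⟩⟩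

/-- The Morse–Hedlund bound: a right special factor of each length makes the complexity strictly
increasing. -/
theorem Aperiodic.lt_complexity (h : Aperiodic w) (n : ℕ) : n < complexity w n := by
  induction n with
  | zero => rw [complexity_zero]; omega
  | succ n ih =>
    rw [complexity_succ]
    obtain ⟨i, -, hi⟩ := h.exists_branchAt_ge 0 n
    have : 0 < {v : List (Fin 2) | v.length = n ∧ RightSpecial w v}.ncard :=
      (Set.ncard_pos (finite_setOf_rightSpecial w n)).2
        ⟨_, length_factorAt w i n, rightSpecial_factorAt_iff.2 hi⟩
    omega

/-- Each factor of a Sturmian word occurs at a positive position. -/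
theorem IsSturmian.exists_succ_sameAt (h : IsSturmian w) (i n : ℕ) :
    ∃ j, SameAt w i (j + 1) n := by
  -- Deleting the first letter leaves an aperiodic word, which still has at least `n + 1` factors of
  -- length `n`; hence none is lost.
  have hap : Aperiodic fun k => w (k + 1) := fun s t hst => by
    obtain ⟨j, hj⟩ := h.aperiodic (s + 1) (t + 1) (by omega)
    exact ⟨j, by simpa [add_right_comm] using hj⟩
  have hfac : ∀ k, factorAt (fun k => w (k + 1)) k n = factorAt w (k + 1) n := fun k =>
    factorAt_eq_factorAt_iff.2 fun t _ => by simp [add_right_comm]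
  have heq := Set.eq_of_subset_of_ncard_le
    (s := {u : List (Fin 2) | IsFactor u (fun k => w (k + 1)) ∧ u.length = n})
    (t := {u : List (Fin 2) | IsFactor u w ∧ u.length = n}) (by
      simp only [setOf_isFactor_eq_range, hfac]
      rintro _ ⟨k, rfl⟩
      exact ⟨k + 1, rfl⟩) (by
      have := hap.lt_complexity n
      have h2 := h n
      rw [complexity] at this h2
      omega) (finite_setOf_isFactor w n)
  simp only [setOf_isFactor_eq_range, hfac] at heq
  have hi : factorAt w i n ∈ Set.range fun i => factorAt w i n := ⟨i, rfl⟩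
  rw [← heq] at hi
  obtain ⟨j, hj⟩ := hi
  exact ⟨j, factorAt_eq_factorAt_iff.1 hj.symm⟩

end Binary

/-! ### Closure of Sturmian words under reversal. -/

section Reversal

variable {α : Type*} {w : ℕ → α} {i j k m n : ℕ}

/-- The set of factors of `w` is closed under reversal. -/
def ReversalClosed (w : ℕ → α) : Prop := ∀ i n, ∃ j, MirrorAt w i j n

theorem MirrorAt.symm (h : MirrorAt w i j n) : MirrorAt w j i n := fun t ht => by
  rw [h _ (by omega)]
  congr 1
  omega

/-- Reversal exchanges the factor at the position `i + k` and the one at the mirror image of that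
position. -/
theorem MirrorAt.sub (h : MirrorAt w i j n) {k' : ℕ} (hk : k + k' + m = n) :
    MirrorAt w (i + k) (j + k') m := fun t ht => by
  rw [add_assoc, h _ (by omega)]
  congr 1
  omega

theorem MirrorAt.trans (h : MirrorAt w i j n) (h' : MirrorAt w j k n) : SameAt w i k n :=
  fun t ht => by
    rw [h' t ht, h _ (by omega)]
    congr 1
    omega

theorem MirrorAt.trans_sameAt (h : MirrorAt w i j n) (h' : SameAt w j k n) : MirrorAt w i k n :=
  fun t ht => (h' t ht).symm.trans (h t ht)

/-- Prolong an occurrence of the reversed factor by `M` letters on the right and reverse again: the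
`M` letters now stand in front of the original factor. -/
theorem ReversalClosed.exists_ge (h : ReversalClosed w) (i n M : ℕ) :
    ∃ j, M ≤ j ∧ SameAt w i j n := by
  obtain ⟨k, hk⟩ := h i n
  obtain ⟨j, hj⟩ := h k (n + M)
  refine ⟨j + M, by omega, hk.trans ?_⟩
  have := hj.sub (k := 0) (k' := M) (m := n) (by omega)
  simpa using this

/-- In a Sturmian word `w`, no palindrome `c` of length `m` and letters `x ≠ y` are such that
`xcx`, `xcy` and `ycy` are factors and `ycx` is not. -/
theorem IsSturmian.false_of_mirrorAt {w : ℕ → Fin 2} (h : IsSturmian w)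
    (hb : BranchAt w i (m + 1)) (hc : MirrorAt w (i + 1) (i + 1) m)
    (hj : SameAt w (i + 1) (j + 1) m) (hne : w i ≠ w j)
    (hext : ∀ k, SameAt w j k (m + 1) → w (k + m + 1) = w j) : False := by
  have hnot : ∀ r ≤ m + 1, ¬ SameAt w i (j + r) (m + 1) := by
    intro r hr hs
    have h0 := hs 0 (by omega)
    have hj1 := hext j (fun _ _ => rfl)
    rcases Nat.eq_zero_or_pos r with rfl | hr0
    · exact hne (by simpa using h0)
    rcases Nat.lt_or_ge m r with hmr | hmr
    · obtain rfl : r = m + 1 := by omega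
      exact hne (by simpa [← add_assoc, hj1] using h0)
    -- A copy of `xc` here covers the final `y` of `ycy`; since `c` is a palindrome, that letter
    -- equals the one at `j + r`, where the copy has its initial `x`.
    have h1 := hs (m - r + 1) (by omega)
    rw [show j + r + (m - r + 1) = j + m + 1 by omega, hj1] at h1
    have h2 := hc (m - r) (by omega)
    have h3 := hj (m - 1 - (m - r)) (by omega)
    rw [show j + 1 + (m - 1 - (m - r)) = j + r + 0 by omega] at h3
    rw [show i + (m - r + 1) = i + 1 + (m - r) by omega, h2, h3, ← h0] at h1
    exact hne h1
  have hnb : ∀ r ≤ m + 1, ¬ BranchAt w (j + r) (m + 1) := fun r hr hbr =>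
    hnot r hr (h.sameAt hb hbr)
  have hcard : ({u : List (Fin 2) | IsFactor u w ∧ u.length = m + 1} \
      {factorAt w i (m + 1)}).ncard = m + 1 := by
    have := h (m + 1)
    rw [complexity] at this
    have hmem : factorAt w i (m + 1) ∈ {u : List (Fin 2) | IsFactor u w ∧ u.length = m + 1} :=
      ⟨isFactor_factorAt _ _ _, length_factorAt _ _ _⟩
    rw [Set.ncard_sdiff_singleton_of_mem hmem, this]
    omega
  -- The `m + 2` windows starting at `j, …, j + m + 1` avoid `xc`, leaving `m + 1` factors for them.
  -- Two windows coincide, so a right special one lies between, but `xc` is the only right special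
  -- factor of this length.
  obtain ⟨r, hr, r', hr', hrr, heq⟩ := Set.exists_ne_map_eq_of_ncard_lt_of_maps_to
    (s := (Finset.range (m + 2) : Set ℕ)) (t := {u : List (Fin 2) | IsFactor u w ∧
      u.length = m + 1} \ {factorAt w i (m + 1)}) (f := fun r => factorAt w (j + r) (m + 1))
    (by rw [hcard, Set.ncard_coe_finset, Finset.card_range]; omega)
    (fun r hr => ⟨⟨isFactor_factorAt _ _ _, length_factorAt _ _ _⟩, fun h1 => hnot r
      (by simpa [Nat.lt_succ_iff] using hr) (factorAt_eq_factorAt_iff.1 h1.symm)⟩)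
    ((finite_setOf_isFactor w _).sdiff)
  simp only [Finset.coe_range, Set.mem_Iio] at hr hr'
  have hs : SameAt w (j + r) (j + r') (m + 1) := factorAt_eq_factorAt_iff.1 heq
  rcases lt_or_gt_of_ne hrr with hlt | hlt
  · obtain ⟨q, h1, h2, h3⟩ := h.aperiodic.exists_branchAt (by omega) hs
    exact hnb (q - j) (by omega) (by rwa [Nat.add_sub_cancel' (by omega)])
  · obtain ⟨q, h1, h2, h3⟩ := h.aperiodic.exists_branchAt (by omega) hs.symm
    exact hnb (q - j) (by omega) (by rwa [Nat.add_sub_cancel' (by omega)])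

/-- The set of factors of a Sturmian word is closed under reversal. -/
theorem IsSturmian.reversalClosed {w : ℕ → Fin 2} (h : IsSturmian w) : ReversalClosed w := by
  intro i n
  induction n generalizing i with
  | zero => exact ⟨0, fun t ht => absurd ht (by omega)⟩
  | succ n ih =>
    rcases n with _ | m
    · refine ⟨i, fun t ht => ?_⟩
      obtain rfl : t = 0 := by omega
      rfl
    by_contra! hno
    -- The factor at `i` is `xcy` with a word `c` of length `m`.
    obtain ⟨j, hj⟩ := ih (i + 1)
    obtain ⟨k, hk⟩ := ih i
    -- A positive position is needed so that a letter, the one at `k'`, precedes the reversal of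
    -- `xc`.
    obtain ⟨k', hk'⟩ := h.exists_succ_sameAt k (m + 1)
    have hk := hk.trans_sameAt hk'
    have hj0 : w j = w (i + m + 1) := by
      have := hj 0 (by omega)
      rw [add_zero] at this
      rw [this]; congr 1; omega
    have hkm : w (k' + m + 1) = w i := by
      have := hk m (by omega)
      rw [show k' + m + 1 = k' + 1 + m by omega, this]; congr 1; omega
    have hjc : MirrorAt w (i + 1) (j + 1) m := by
      simpa using hj.sub (k := 0) (k' := 1) (m := m) (by omega)
    have hkc : MirrorAt w (i + 1) (k' + 1) m := by
      simpa using hk.sub (k := 1) (k' := 0) (m := m) (by omega)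
    -- By assumption the reversal of `xcy` is not a factor: the reversal of `c`, when preceded by
    -- `y`, is never followed by `x`.
    have hno' : ∀ q, w q = w (i + m + 1) → MirrorAt w (i + 1) (q + 1) m →
        w (q + m + 1) ≠ w i := by
      intro q h1 h2 h3
      refine hno q fun t ht => ?_
      rcases Nat.eq_zero_or_pos t with rfl | ht0
      · rw [add_zero, h1]; congr 1
      rcases Nat.lt_or_ge m t with hmt | hmt
      · obtain rfl : t = m + 1 := by omega
        rw [← add_assoc, h3]; congr 1; omega
      · have := h2 (t - 1) (by omega)
        rw [show q + 1 + (t - 1) = q + t by omega] at this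
        rw [this]; congr 1; omega
    have hjk : SameAt w (j + 1) (k' + 1) m := hjc.symm.trans hkc
    have hjm := hno' j hj0 hjc
    have hk0 : w k' ≠ w j := fun h1 => hno' k' (h1.trans hj0) hkc hkm
    -- The reversal of `c` is right special.
    have hbj : BranchAt w (j + 1) m := ⟨k' + 1, hjk, by
      rw [show j + 1 + m = j + m + 1 by omega, show k' + 1 + m = k' + m + 1 by omega, hkm]
      exact hjm⟩
    -- So is `c`.
    have hbi : BranchAt w (i + 1) m := by
      obtain ⟨p, hp⟩ := ih j
      obtain ⟨q, hq⟩ := ih k'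
      have h1 : MirrorAt w (j + 1) p m := by
        simpa using hp.sub (k := 1) (k' := 0) (m := m) (by omega)
      have h2 : MirrorAt w (k' + 1) q m := by
        simpa using hq.sub (k := 1) (k' := 0) (m := m) (by omega)
      have h3 : SameAt w p q m := fun t ht => by
        rw [h1 t ht, h2 t ht]
        exact hjk _ (by omega)
      refine BranchAt.of_sameAt (i := p) ⟨q, h3, ?_⟩ (hjc.trans h1).symm
      have h4 := hp m (by omega)
      have h5 := hq m (by omega)
      rw [h4, h5, show m + 1 - 1 - m = 0 by omega]
      exact hk0.symm
    have hij := h.sameAt hbi hbj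
    have hpal : MirrorAt w (i + 1) (i + 1) m := hjc.trans_sameAt hij.symm
    have hxy : w i ≠ w j := by
      intro h1
      refine hno' i (h1.trans hj0) hpal ?_
      rw [← hj0, h1]
    have hki : w k' = w i := fin_two_eq_of_ne hk0.symm hxy.symm
    have hbr : BranchAt w i (m + 1) := by
      refine ⟨k', fun t ht => ?_, ?_⟩
      · rcases Nat.eq_zero_or_pos t with rfl | ht0
        · exact hki.symm
        · have := (hij.trans hjk) (t - 1) (by omega)
          rwa [show i + 1 + (t - 1) = i + t by omega, show k' + 1 + (t - 1) = k' + t by omega]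
            at this
      · rw [← add_assoc, ← add_assoc, hkm, ← hj0]
        exact hxy.symm
    refine h.false_of_mirrorAt hbr hpal hij hxy fun q hq => ?_
    have h1 : SameAt w (j + 1) (q + 1) m := hq.shift (by omega)
    have h2 : w q = w j := (hq 0 (by omega)).symm
    exact fin_two_eq_of_ne (hno' q (h2.trans hj0) (hjc.trans_sameAt h1)).symm hxy

end Reversal

/-! ### Rote words and their Sturmian differences. -/

section Rote

variable {w : ℕ → Fin 2} {i j k m n : ℕ}

/-- The set of factors of `w` is closed under complementation. -/
def ComplClosed (w : ℕ → Fin 2) : Prop := ∀ i n, ∃ j, OppAt w i j n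

theorem OppAt.symm (h : OppAt w i j n) : OppAt w j i n := fun t ht => (h t ht).symm

theorem OppAt.trans (h : OppAt w i j n) (h' : OppAt w j k n) : SameAt w i k n :=
  fun t ht => fin_two_eq_of_ne (h t ht).symm (h' t ht)

theorem OppAt.trans_sameAt (h : OppAt w i j n) (h' : SameAt w j k n) : OppAt w i k n :=
  fun t ht => h' t ht ▸ h t ht

theorem SameAt.trans_oppAt (h : SameAt w i j n) (h' : OppAt w j k n) : OppAt w i k n :=
  (h'.symm.trans_sameAt h.symm).symm

theorem OppAt.mono (h : OppAt w i j n) (hmn : m ≤ n) : OppAt w i j m := fun t ht => h t (by omega)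

theorem OppAt.shift (h : OppAt w i j n) (hmn : k + m ≤ n) : OppAt w (i + k) (j + k) m :=
  fun t ht => by simpa [add_assoc] using h (k + t) (by omega)

theorem OppAt.succ (h : OppAt w i j n) (h' : w (i + n) ≠ w (j + n)) : OppAt w i j (n + 1) := by
  intro t ht
  rcases Nat.lt_succ_iff_lt_or_eq.1 ht with ht | rfl
  exacts [h t ht, h']

theorem SameAt.not_oppAt (h : SameAt w i j n) (hn : 1 ≤ n) : ¬ OppAt w i j n :=
  fun h' => h' 0 hn (h 0 hn)

theorem BranchAt.of_oppAt (hc : ComplClosed w) (h : BranchAt w i n) (hs : OppAt w i j n) :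
    BranchAt w j n := by
  obtain ⟨k, hk, hne⟩ := h
  obtain ⟨i', hi'⟩ := hc i (n + 1)
  obtain ⟨k', hk'⟩ := hc k (n + 1)
  have h1 : BranchAt w i' n := by
    refine ⟨k', ((hi'.mono (by omega)).symm.trans_sameAt hk).trans (hk'.mono (by omega)), ?_⟩
    intro h2
    exact hne (fin_two_eq_of_ne (hi' n (by omega)).symm (h2 ▸ (hk' n (by omega)).symm))
  exact h1.of_sameAt ((hi'.mono (by omega)).symm.trans hs)

theorem compl_eq_factorAt_iff : compl (factorAt w i n) = factorAt w j n ↔ OppAt w i j n := by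
  have h : ∀ a b : Fin 2, 1 - a = b ↔ a ≠ b := by decide
  simp [compl, factorAt, h, OppAt]

theorem complClosed_iff :
    (∀ u : List (Fin 2), IsFactor u w → IsFactor (compl u) w) ↔ ComplClosed w := by
  constructor
  · intro h i n
    obtain ⟨j, hj⟩ := isFactor_iff_exists_eq.1 (h _ (isFactor_factorAt w i n))
    rw [compl, List.length_map, length_factorAt] at hj
    exact ⟨j, compl_eq_factorAt_iff.1 hj⟩
  · rintro h _ ⟨i, n, rfl⟩
    obtain ⟨j, hj⟩ := h i n
    exact ⟨j, n, compl_eq_factorAt_iff.2 hj⟩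

theorem SameAt.firstDiff (h : SameAt w i j (n + 1)) : SameAt (firstDiff w) i j n := fun t ht => by
  have h1 := h t (by omega)
  have h2 := h (t + 1) (by omega)
  simp only [RichWords.firstDiff]
  rw [h1, add_assoc i, h2, ← add_assoc]

theorem OppAt.firstDiff (h : OppAt w i j (n + 1)) : SameAt (firstDiff w) i j n := fun t ht => by
  have h1 := h t (by omega)
  have h2 := h (t + 1) (by omega)
  rw [← add_assoc, ← add_assoc] at h2
  simp only [RichWords.firstDiff]
  have key : ∀ a b c d : Fin 2, a ≠ b → c ≠ d → a + c = b + d := by decide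
  exact key _ _ _ _ h1 h2

theorem firstDiff_eq_iff : firstDiff w i = firstDiff w j ↔
    (w i = w j ↔ w (i + 1) = w (j + 1)) := by
  have key : ∀ a b c d : Fin 2, a + c = b + d ↔ (a = b ↔ c = d) := by decide
  exact key _ _ _ _

theorem sameAt_of_firstDiff (h : SameAt (firstDiff w) i j n) (h0 : w i = w j) :
    SameAt w i j (n + 1) := by
  induction n with
  | zero => exact fun t ht => by obtain rfl : t = 0 := by omega
                                 exact h0
  | succ n ih =>
    refine (ih (h.mono (by omega))).succ ?_
    exact (firstDiff_eq_iff.1 (h n (by omega))).1 (ih (h.mono (by omega)) n (by omega))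

theorem oppAt_of_firstDiff (h : SameAt (firstDiff w) i j n) (h0 : w i ≠ w j) :
    OppAt w i j (n + 1) := by
  induction n with
  | zero => exact fun t ht => by obtain rfl : t = 0 := by omega
                                 exact h0
  | succ n ih =>
    refine (ih (h.mono (by omega))).succ ?_
    exact (not_congr (firstDiff_eq_iff.1 (h n (by omega)))).1
      (ih (h.mono (by omega)) n (by omega))

theorem sameAt_or_oppAt_of_firstDiff (h : SameAt (firstDiff w) i j n) :
    SameAt w i j (n + 1) ∨ OppAt w i j (n + 1) :=
  (em (w i = w j)).imp (sameAt_of_firstDiff h) (oppAt_of_firstDiff h)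

/-- When two occurrences with the same differences are opposite, complementing the second, prolonged
by one letter, makes them equal and leaves all differences unchanged. -/
theorem branchAt_firstDiff_iff (hc : ComplClosed w) :
    BranchAt (firstDiff w) i n ↔ BranchAt w i (n + 1) := by
  have key : ∀ j, SameAt w i j (n + 1) →
      (firstDiff w (i + n) ≠ firstDiff w (j + n) ↔ w (i + (n + 1)) ≠ w (j + (n + 1))) := by
    intro j hj
    rw [Ne, firstDiff_eq_iff, iff_true_left (hj n (by omega))]
    rfl
  constructor
  · rintro ⟨j, hj, hne⟩
    rcases sameAt_or_oppAt_of_firstDiff hj with h | h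
    · exact ⟨j, h, (key j h).1 hne⟩
    · obtain ⟨k, hk⟩ := hc j (n + 1 + 1)
      have h1 := h.trans (hk.mono (by omega))
      refine ⟨k, h1, (key k h1).1 ?_⟩
      rwa [← hk.firstDiff n (by omega)]
  · rintro ⟨j, hj, hne⟩
    exact ⟨j, hj.firstDiff, (key j hj).2 hne⟩

theorem IsCSRote.complClosed (h : IsCSRote w) : ComplClosed w := complClosed_iff.1 h.1

/-- The first differences of a complementary symmetric Rote word form a Sturmian word. -/
theorem IsCSRote.isSturmian_firstDiff (h : IsCSRote w) : IsSturmian (firstDiff w) := by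
  have hc := h.complClosed
  refine isSturmian_of_existsUnique fun n => ?_
  have hcard : {v : List (Fin 2) | v.length = n + 1 ∧ RightSpecial w v}.ncard = 2 := by
    have := complexity_succ w (n + 1)
    rw [h.2 _ (by omega), h.2 _ (by omega)] at this
    omega
  have hmem : ∀ i, BranchAt (firstDiff w) i n →
      factorAt w i (n + 1) ∈ {v : List (Fin 2) | v.length = n + 1 ∧ RightSpecial w v} :=
    fun i hi => ⟨length_factorAt _ _ _,
      rightSpecial_factorAt_iff.2 ((branchAt_firstDiff_iff hc).1 hi)⟩
  obtain ⟨v, hv1, hv2⟩ : {v : List (Fin 2) | v.length = n + 1 ∧ RightSpecial w v}.Nonempty := by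
    rw [← Set.ncard_pos (finite_setOf_rightSpecial w _)]
    omega
  obtain ⟨i, hi, hbi⟩ := hv2.exists_eq
  rw [hv1] at hi hbi
  rw [← branchAt_firstDiff_iff hc] at hbi
  refine ⟨factorAt (firstDiff w) i n, ⟨length_factorAt _ _ _, rightSpecial_factorAt_iff.2 hbi⟩, ?_⟩
  rintro v' ⟨hv', hr⟩
  obtain ⟨j, hj, hbj⟩ := hr.exists_eq
  rw [hv'] at hj hbj
  rw [hj, factorAt_eq_factorAt_iff]
  obtain ⟨k, hk⟩ := hc i (n + 1)
  have hbk : BranchAt (firstDiff w) k n := hbi.of_sameAt hk.firstDiff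
  by_contra hne
  -- The factors at `i` and `k` are complementary; a second right special word of differences would
  -- give a third right special factor of `w`, but there are only two.
  have hsub : {factorAt w i (n + 1), factorAt w k (n + 1), factorAt w j (n + 1)} ⊆
      {v : List (Fin 2) | v.length = n + 1 ∧ RightSpecial w v} := by
    rintro _ (rfl | rfl | rfl)
    exacts [hmem _ hbi, hmem _ hbk, hmem _ hbj]
  have h3 := Set.ncard_le_ncard hsub (finite_setOf_rightSpecial w _)
  have hik : factorAt w i (n + 1) ≠ factorAt w k (n + 1) := fun h1 =>
    SameAt.not_oppAt (factorAt_eq_factorAt_iff.1 h1) (by omega) hk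
  have hij : factorAt w i (n + 1) ≠ factorAt w j (n + 1) := fun h1 =>
    hne (SameAt.firstDiff (factorAt_eq_factorAt_iff.1 h1)).symm
  have hkj : factorAt w k (n + 1) ≠ factorAt w j (n + 1) := fun h1 =>
    hne (hk.firstDiff.trans (SameAt.firstDiff (factorAt_eq_factorAt_iff.1 h1))).symm
  rw [Set.ncard_insert_of_notMem (by simp [hik, hij]), Set.ncard_pair hkj, hcard] at h3
  omega

/-- The unique right special word of differences lifts to exactly two right special factors,
complements of each other, so the complexity grows by 2 at each length `n ≥ 1`. -/
theorem isCSRote_of_isSturmian_firstDiff (h : IsSturmian (firstDiff w)) (hc : ComplClosed w) :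
    IsCSRote w := by
  refine ⟨complClosed_iff.2 hc, fun n hn => ?_⟩
  induction n, hn using Nat.le_induction with
  | base =>
    have h0 : {v : List (Fin 2) | v.length = 0 ∧ RightSpecial w v} = {[]} := by
      ext v
      simp only [List.length_eq_zero_iff, Set.mem_ofPred_eq, Set.mem_singleton_iff,
        and_iff_left_iff_imp]
      rintro rfl a
      obtain ⟨i, hi⟩ := hc 0 1
      have hi := hi 0 (by omega)
      by_cases ha : a = w 0
      · exact ⟨0, 1, by simp [factorAt, ha]⟩
      · exact ⟨i, 1, by simpa [factorAt] using fin_two_eq_of_ne (Ne.symm ha) hi⟩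
    rw [show 1 = 0 + 1 from rfl, complexity_succ, complexity_zero, h0, Set.ncard_singleton]
  | succ n hn ih =>
    obtain ⟨n, rfl⟩ := Nat.exists_eq_add_of_le' hn
    rw [complexity_succ, ih]
    obtain ⟨v, hv⟩ := Set.ncard_eq_one.1 (ncard_rightSpecial_of_isSturmian h n)
    obtain ⟨hv1, hv2⟩ : v ∈ {v : List (Fin 2) | v.length = n ∧ RightSpecial (firstDiff w) v} :=
      hv ▸ rfl
    obtain ⟨i, hi, hbi⟩ := hv2.exists_eq
    rw [hv1] at hbi
    obtain ⟨k, hk⟩ := hc i (n + 1)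
    rw [Set.ncard_eq_two.2 ⟨factorAt w i (n + 1), factorAt w k (n + 1), fun h1 =>
      SameAt.not_oppAt (factorAt_eq_factorAt_iff.1 h1) (by omega) hk, ?_⟩]
    · omega
    ext v'
    simp only [Set.mem_ofPred_eq, Set.mem_insert_iff, Set.mem_singleton_iff]
    constructor
    · rintro ⟨h1, h2⟩
      obtain ⟨j, hj, hbj⟩ := h2.exists_eq
      rw [h1] at hj hbj
      rw [hj, factorAt_eq_factorAt_iff, factorAt_eq_factorAt_iff]
      have h3 := h.sameAt ((branchAt_firstDiff_iff hc).2 hbj) hbi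
      exact (sameAt_or_oppAt_of_firstDiff h3).imp id fun h4 => h4.trans hk
    · rintro (rfl | rfl) <;> refine ⟨length_factorAt _ _ _, rightSpecial_factorAt_iff.2 ?_⟩
      · exact (branchAt_firstDiff_iff hc).1 hbi
      · exact (branchAt_firstDiff_iff hc).1 (hbi.of_sameAt hk.firstDiff)

/-- The set of factors of a complementary symmetric Rote word is closed under reversal. -/
theorem IsCSRote.reversalClosed (h : IsCSRote w) : ReversalClosed w := by
  intro i n
  rcases n with _ | n
  · exact ⟨0, fun t ht => absurd ht (by omega)⟩
  obtain ⟨j, hj⟩ := h.isSturmian_firstDiff.reversalClosed i n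
  -- Mirrored differences make the comparison with the mirror image constant along the block, which
  -- is therefore the reversal or its complement.
  have key : ∀ t ≤ n, (w (j + t) = w (i + (n - t)) ↔ w j = w (i + n)) := by
    intro t ht
    induction t with
    | zero => simp
    | succ t ih =>
      rw [← ih (by omega)]
      have h1 := hj t (by omega)
      simp only [firstDiff] at h1
      rw [show i + (n - 1 - t) + 1 = i + (n - t) by omega,
        show i + (n - 1 - t) = i + (n - (t + 1)) by omega] at h1
      have key : ∀ a b c d : Fin 2, a + b = c + d → (b = c ↔ a = d) := by decide
      exact key _ _ _ _ h1
  by_cases h0 : w j = w (i + n)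
  · exact ⟨j, fun t ht => by simpa using (key t (by omega)).2 h0⟩
  · obtain ⟨k, hk⟩ := h.complClosed j (n + 1)
    exact ⟨k, fun t ht => by
      have := (not_congr (key t (by omega))).2 h0
      exact fin_two_eq_of_ne (hk t ht) this⟩

end Rote

/-! ### Complete returns to right special palindromes. -/

section Returns

variable {w : ℕ → Fin 2} {i j k m n : ℕ}

/-- The hypotheses under which palindromic returns are studied: the properties of complementary
symmetric Rote words that are used. -/
structure RoteLike (w : ℕ → Fin 2) : Prop where
  complClosed : ComplClosed w
  reversalClosed : ReversalClosed w
  aperiodic : Aperiodic w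
  sameAt_or_oppAt : ∀ {i j n}, BranchAt w i n → BranchAt w j n → SameAt w i j n ∨ OppAt w i j n

theorem IsCSRote.roteLike (h : IsCSRote w) : RoteLike w where
  complClosed := h.complClosed
  reversalClosed := h.reversalClosed
  aperiodic := aperiodic_of_complexity fun n => ⟨n + 1, by rw [h.2 _ (by omega)]; omega⟩
  sameAt_or_oppAt {i j n} hi hj := by
    rcases n with _ | n
    · exact Or.inl fun t ht => absurd ht (by omega)
    · exact sameAt_or_oppAt_of_firstDiff (h.isSturmian_firstDiff.sameAt
        ((branchAt_firstDiff_iff h.complClosed).2 hi) ((branchAt_firstDiff_iff h.complClosed).2 hj))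

/-- The factor of length `n` at the position `i` is a palindrome. -/
abbrev PalAt (w : ℕ → Fin 2) (i n : ℕ) : Prop := MirrorAt w i i n

theorem MirrorAt.palAt_of_sameAt (h : MirrorAt w i j n) (hs : SameAt w i j n) : PalAt w i n :=
  h.trans_sameAt hs.symm

theorem PalAt.of_sameAt (h : PalAt w i n) (hs : SameAt w i j n) : PalAt w j n := fun t ht => by
  rw [← hs t ht, h t ht, hs _ (by omega)]

theorem PalAt.of_oppAt (h : PalAt w i n) (hs : OppAt w i j n) : PalAt w j n := fun t ht =>
  fin_two_eq_of_ne (h t ht ▸ hs t ht) (hs _ (by omega))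

theorem MirrorAt.sameAt_of_palAt (h : MirrorAt w i j n) (hp : PalAt w i n) : SameAt w i j n :=
  hp.trans h

/-- A palindrome extends to a longer one. -/
theorem RoteLike.exists_palAt_add_two (h : RoteLike w) (hp : PalAt w i n) (hn : 1 ≤ n) :
    ∃ j, PalAt w j (n + 2) := by
  have ext : ∀ j, PalAt w (j + 1) n → w (j + n + 1) = w j → PalAt w j (n + 2) := by
    intro j h1 h2 t ht
    rcases Nat.eq_zero_or_pos t with rfl | ht0
    · rw [add_zero, ← h2]; congr 1
    rcases Nat.lt_or_ge n t with hmt | hmt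
    · obtain rfl : t = n + 1 := by omega
      rw [← add_assoc, h2]; congr 1; omega
    · have := h1 (t - 1) (by omega)
      rw [show j + 1 + (t - 1) = j + t by omega] at this
      rw [this]; congr 1; omega
  by_cases hb : BranchAt w i n
  · obtain ⟨q, -, hq⟩ := h.aperiodic.exists_branchAt_ge 0 (n + 1)
    obtain ⟨q', hq', hs⟩ : ∃ q, BranchAt w q (n + 1) ∧ SameAt w i (q + 1) n := by
      rcases h.sameAt_or_oppAt hb (hq.shift (k := 1) (m := n) (by omega)) with hs | hs
      · exact ⟨q, hq, hs⟩
      · obtain ⟨q', hq'⟩ := h.complClosed q (n + 1)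
        exact ⟨q', hq.of_oppAt h.complClosed hq', hs.trans (hq'.shift (by omega))⟩
    have hp' := hp.of_sameAt hs
    obtain ⟨r, hr, hne⟩ := hq'
    by_cases hx : w (q' + n + 1) = w q'
    · exact ⟨q', ext q' hp' hx⟩
    · refine ⟨r, ext r (hp'.of_sameAt (hr.shift (by omega))) ?_⟩
      have := hr 0 (by omega)
      rw [add_zero, add_zero] at this
      rw [← this]
      exact fin_two_eq_of_ne hne hx
  · obtain ⟨s, hs1, hs⟩ := h.reversalClosed.exists_ge i n 1
    obtain ⟨s, rfl⟩ := Nat.exists_eq_add_of_le' hs1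
    have hp' := hp.of_sameAt hs
    -- Here the letter after `p` is forced. Reversing `apb` gives `bpa`, so `a = b`.
    obtain ⟨q, hq⟩ := h.reversalClosed s (n + 2)
    have hsq : SameAt w (s + 1) (q + 1) n :=
      hp'.trans (by simpa using hq.sub (k := 1) (k' := 1) (m := n) (by omega))
    have h1 := eq_of_not_branchAt hb (hs.trans hsq)
    have h2 := eq_of_not_branchAt hb hs
    have h3 := hq (n + 1) (by omega)
    refine ⟨s, ext s hp' ?_⟩
    rw [show s + n + 1 = s + 1 + n by omega, ← h2, h1, show q + 1 + n = q + (n + 1) by omega, h3]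
    congr 1
    omega

/-- There are palindromes of all lengths. -/
theorem RoteLike.exists_palAt (h : RoteLike w) (n : ℕ) : ∃ i, PalAt w i n := by
  induction n using Nat.twoStepInduction with
  | zero => exact ⟨0, fun t ht => absurd ht (by omega)⟩
  | one => exact ⟨0, fun t ht => by obtain rfl : t = 0 := by omega
                                    rfl⟩
  | more n ih _ =>
    rcases n with _ | n
    · obtain ⟨i, hi⟩ : ∃ i, w i = w (i + 1) := by
        by_contra! hne
        obtain ⟨j, hj⟩ := h.aperiodic 0 2 (by omega)
        refine hj ?_
        rw [zero_add, show 2 + j = j + 1 + 1 by omega]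
        exact fin_two_eq_of_ne (hne j).symm (hne (j + 1))
      refine ⟨i, fun t ht => ?_⟩
      obtain rfl | rfl : t = 0 ∨ t = 1 := by omega
      exacts [hi, hi.symm]
    · obtain ⟨i, hi⟩ := ih
      exact h.exists_palAt_add_two hi (by omega)

/-- After a factor `p`, the word is determined by one letter until the next right special factor
of length `n`. -/
theorem sameAt_of_not_branchAt (hs : SameAt w i j (n + 1))
    (hb : ∀ r, 1 ≤ r → r < k → ¬ BranchAt w (i + r) n) : SameAt w i j (n + k) := by
  induction k with
  | zero => exact hs.mono (by omega)
  | succ k ih =>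
    rcases Nat.eq_zero_or_pos k with rfl | hk
    · exact hs
    have h1 := ih fun r h1 h2 => hb r h1 (by omega)
    refine h1.succ ?_
    have := eq_of_not_branchAt (hb k hk (by omega)) (h1.shift (k := k) (m := n) (by omega))
    rwa [add_assoc, add_assoc, add_comm k n] at this

/-- A palindromic right special factor, the one of length `n` at the position `o`. -/
structure Pivot (w : ℕ → Fin 2) (o n : ℕ) : Prop extends RoteLike w where
  pos : 1 ≤ n
  palAt : PalAt w o n
  branchAt : BranchAt w o n

namespace Pivot

variable {o : ℕ}

theorem branchAt_iff (h : Pivot w o n) :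
    BranchAt w i n ↔ SameAt w o i n ∨ OppAt w o i n := by
  refine ⟨fun hi => h.sameAt_or_oppAt h.branchAt hi, ?_⟩
  rintro (hi | hi)
  exacts [h.branchAt.of_sameAt hi, h.branchAt.of_oppAt h.complClosed hi]

theorem not_oppAt (h : Pivot w o n) (hi : SameAt w o i n) : ¬ OppAt w o i n :=
  hi.not_oppAt h.pos

/-- Since the pivot and its complement are palindromes, reversing a longer factor only moves their
occurrences to the mirror positions. -/
theorem branchAt_sub_iff (h : Pivot w o n) (hm : MirrorAt w i j (k + n)) {r : ℕ} (hr : r ≤ k) :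
    (SameAt w o (j + r) n ↔ SameAt w o (i + (k - r)) n) ∧
      (OppAt w o (j + r) n ↔ OppAt w o (i + (k - r)) n) := by
  have hm' : MirrorAt w (i + (k - r)) (j + r) n := hm.sub (by omega)
  refine ⟨⟨fun h1 => ?_, fun h1 => ?_⟩, ⟨fun h1 => ?_, fun h1 => ?_⟩⟩
  · exact h1.trans (hm'.symm.sameAt_of_palAt (h.palAt.of_sameAt h1))
  · exact h1.trans (hm'.sameAt_of_palAt (h.palAt.of_sameAt h1))
  · exact h1.trans_sameAt (hm'.symm.sameAt_of_palAt (h.palAt.of_oppAt h1))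
  · exact h1.trans_sameAt (hm'.sameAt_of_palAt (h.palAt.of_oppAt h1))

/-- Complementation preserves right special factors. -/
theorem branchAt_compl_iff (h : Pivot w o n) (hij : OppAt w i j n) :
    BranchAt w i n ↔ BranchAt w j n :=
  ⟨fun hi => hi.of_oppAt h.complClosed hij, fun hj => hj.of_oppAt h.complClosed hij.symm⟩

theorem oppAt_of_not_branchAt (h : Pivot w o n) (hs : OppAt w i j (n + 1))
    (hb : ∀ r, 1 ≤ r → r < k → ¬ BranchAt w (i + r) n) : OppAt w i j (n + k) := by
  obtain ⟨q, hq⟩ := h.complClosed j (n + k + 1)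
  exact (sameAt_of_not_branchAt (hs.trans (hq.mono (by omega))) hb).trans_oppAt
    (hq.symm.mono (by omega))

/-- There is a return to the pivot that avoids its complement. -/
theorem exists_loop (h : Pivot w o n) : ∃ i m, 1 ≤ m ∧ SameAt w o i n ∧ SameAt w o (i + m) n ∧
    ∀ r, 1 ≤ r → r < m → ¬ BranchAt w (i + r) n := by
  obtain ⟨K, hK⟩ := h.aperiodic.exists_branchAt_bounded n
  -- This palindrome has `2 * K + 2` windows of length `n`, an even number, so no window is its own
  -- mirror image. The last right special window of the first half and its mirror image are
  -- consecutive right special windows carrying the same word.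
  obtain ⟨s, hs⟩ := h.exists_palAt (2 * K + 1 + n)
  have hmir : ∀ r ≤ 2 * K + 1, MirrorAt w (s + (2 * K + 1 - r)) (s + r) n := fun r hr =>
    hs.sub (by omega)
  have hbr : ∀ r ≤ 2 * K + 1, BranchAt w (s + r) n → SameAt w (s + r) (s + (2 * K + 1 - r)) n := by
    intro r hr hb
    have hp : PalAt w (s + r) n := by
      rcases h.branchAt_iff.1 hb with hb | hb
      exacts [h.palAt.of_sameAt hb, h.palAt.of_oppAt hb]
    exact (hmir r hr).symm.sameAt_of_palAt hp
  -- The last right special factor in the first half of the palindrome.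
  have hex : ∃ r ≤ K, BranchAt w (s + r) n := by
    obtain ⟨q, h1, h2, hq⟩ := hK s
    exact ⟨q - s, by omega, by rwa [Nat.add_sub_cancel' h1]⟩
  classical
  let P : ℕ → Prop := fun r => BranchAt w (s + r) n
  obtain ⟨r0, hr0, hr0'⟩ := hex
  have hP : P (Nat.findGreatest P K) := Nat.findGreatest_spec hr0 hr0'
  have hle : Nat.findGreatest P K ≤ K := Nat.findGreatest_le K
  have hmax : ∀ r, Nat.findGreatest P K < r → r ≤ K → ¬ P r := fun r h1 h2 =>
    Nat.findGreatest_is_greatest h1 h2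
  generalize Nat.findGreatest P K = r1 at hP hle hmax
  have hend := hbr r1 (by omega) hP
  have hno : ∀ r, 1 ≤ r → r < 2 * K + 1 - 2 * r1 → ¬ BranchAt w (s + r1 + r) n := by
    intro r h1 h2 h3
    rw [add_assoc] at h3
    by_cases hr : r1 + r ≤ K
    · exact hmax _ (by omega) hr h3
    · exact hmax (2 * K + 1 - (r1 + r)) (by omega) (by omega)
        (h3.of_sameAt (hbr _ (by omega) h3))
  have hlen : s + (2 * K + 1 - r1) = s + r1 + (2 * K + 1 - 2 * r1) := by omega
  rw [hlen] at hend
  rcases h.branchAt_iff.1 hP with hP | hP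
  · exact ⟨s + r1, _, by omega, hP, hP.trans hend, hno⟩
  · obtain ⟨q, hq⟩ := h.complClosed (s + r1) (2 * K + 1 - 2 * r1 + n)
    have h1 : SameAt w o q n := hP.trans (hq.mono (by omega))
    refine ⟨q, _, by omega, h1, ?_, fun r hr hr' hb => hno r hr hr' ?_⟩
    · exact (hP.trans_sameAt hend).trans (hq.shift (by omega))
    · exact (h.branchAt_compl_iff (hq.shift (by omega))).2 hb

/-- The complete returns to the pivot are palindromes. -/
theorem palAt_return (h : Pivot w o n) (hi : SameAt w o i n) (hk : 1 ≤ k)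
    (hik : SameAt w o (i + k) n) (hno : ∀ r, 1 ≤ r → r < k → ¬ SameAt w o (i + r) n) :
    PalAt w i (k + n) := by
  obtain ⟨q, m, hm, hq, hqm, hqno⟩ := h.exists_loop
  -- The letter `w (q + n)` after the pivot leads back to it, without meeting its complement.
  have loop : ∀ j, SameAt w o j n → w (j + n) = w (q + n) →
      SameAt w o (j + m) n ∧ ∀ r, 1 ≤ r → r < m → ¬ BranchAt w (j + r) n := by
    intro j hj hl
    have h1 : SameAt w q j (n + m) :=
      sameAt_of_not_branchAt ((hq.symm.trans hj).succ hl.symm) hqno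
    exact ⟨hqm.trans (h1.shift (by omega)), fun r hr hr' hb =>
      hqno r hr hr' (hb.of_sameAt (h1.shift (by omega)).symm)⟩
  have loop' : ∀ j, OppAt w o j n → w (j + n) ≠ w (q + n) →
      OppAt w o (j + m) n ∧ ∀ r, 1 ≤ r → r < m → ¬ BranchAt w (j + r) n := by
    intro j hj hl
    have h1 : OppAt w q j (n + m) :=
      h.oppAt_of_not_branchAt ((hq.symm.trans_oppAt hj).succ hl.symm) hqno
    exact ⟨hqm.trans_oppAt (h1.shift (by omega)), fun r hr hr' hb =>
      hqno r hr hr' ((h.branchAt_compl_iff (h1.shift (by omega))).2 hb)⟩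
  -- The other letter does not.
  have only : ∀ j l, 1 ≤ l → SameAt w o j n → SameAt w o (j + l) n →
      (∀ r, 1 ≤ r → r < l → ¬ BranchAt w (j + r) n) → w (j + n) = w (q + n) := by
    intro j l hl hj hjl hjno
    by_contra hne
    -- If both letters after the pivot led back to it, its complement could never be reached from
    -- it.
    have never : ∀ d p, SameAt w o p n → ¬ OppAt w o (p + d) n := by
      intro d
      induction d using Nat.strong_induction_on with
      | _ d ih =>
        intro p hp hpd
        have hnext : ∃ e, 1 ≤ e ∧ SameAt w o (p + e) n ∧
            ∀ r, 1 ≤ r → r < e → ¬ BranchAt w (p + r) n := by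
          by_cases hpl : w (p + n) = w (q + n)
          · exact ⟨m, hm, loop p hp hpl⟩
          · have h1 : SameAt w j p (n + l) := sameAt_of_not_branchAt
              ((hj.symm.trans hp).succ (fin_two_eq_of_ne (Ne.symm hne) (Ne.symm hpl))) hjno
            exact ⟨l, hl, hjl.trans (h1.shift (by omega)), fun r hr hr' hb =>
              hjno r hr hr' (hb.of_sameAt (h1.shift (by omega)).symm)⟩
        obtain ⟨e, he, hpe, heno⟩ := hnext
        rcases Nat.eq_zero_or_pos d with rfl | hd
        · exact h.not_oppAt hp hpd
        rcases Nat.lt_or_ge d e with hde | hde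
        · exact heno d hd hde (h.branchAt_iff.2 (Or.inr hpd))
        · refine ih (d - e) (by omega) (p + e) hpe ?_
          rwa [show p + e + (d - e) = p + d by omega]
    -- If the complement occurs only before the pivot at `o`, the complement of the stretch between
    -- them has the two in the desired order.
    obtain ⟨o', ho'⟩ := h.complClosed o n
    rcases le_total o o' with hle | hle
    · exact never (o' - o) o (fun _ _ => rfl) (by rwa [Nat.add_sub_cancel' hle])
    · obtain ⟨z, hz⟩ := h.complClosed o' (o - o' + n)
      refine never (o - o') z (ho'.trans (hz.mono (by omega))) ?_
      have := hz.shift (k := o - o') (m := n) le_rfl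
      rwa [Nat.add_sub_cancel' hle] at this
  obtain ⟨j, hj⟩ := h.reversalClosed i (k + n)
  refine hj.palAt_of_sameAt ?_
  have hj0 : SameAt w o j n := by
    simpa using ((h.branchAt_sub_iff hj (Nat.zero_le k)).1).2 (by simpa using hik)
  have hjk : SameAt w o (j + k) n := ((h.branchAt_sub_iff hj le_rfl).1).2 (by simpa using hi)
  have hjno : ∀ r, 1 ≤ r → r < k → ¬ SameAt w o (j + r) n := fun r hr hr' hb =>
    hno (k - r) (by omega) (by omega) ((h.branchAt_sub_iff hj (by omega)).1.1 hb)
  -- The first letter of a return tells whether it avoids the complement of the pivot, a property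
  -- that reversal preserves.
  have hletter : ∀ p, SameAt w o p n → SameAt w o (p + k) n →
      (∀ r, 1 ≤ r → r < k → ¬ SameAt w o (p + r) n) →
      (w (p + n) = w (q + n) ↔ ∀ r, 1 ≤ r → r < k → ¬ OppAt w o (p + r) n) := by
    intro p hp hpk hpno
    constructor
    · intro hpl r hr hr' hopp
      obtain ⟨h1, h2⟩ := loop p hp hpl
      have : k ≤ m := by
        by_contra! hlt
        exact hpno m hm hlt h1
      exact h2 r hr (by omega) (h.branchAt_iff.2 (Or.inr hopp))
    · intro h1
      exact only p k hk hp hpk fun r hr hr' hb => (h.branchAt_iff.1 hb).elim (hpno r hr hr')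
        (h1 r hr hr')
  have hij : w (i + n) = w (q + n) ↔ w (j + n) = w (q + n) := by
    rw [hletter i hi hik hno, hletter j hj0 hjk hjno]
    constructor
    · intro h1 r hr hr' hb
      exact h1 (k - r) (by omega) (by omega) ((h.branchAt_sub_iff hj (by omega)).2.1 hb)
    · intro h1 r hr hr' hb
      refine h1 (k - r) (by omega) (by omega) ((h.branchAt_sub_iff hj (by omega)).2.2 ?_)
      rwa [show k - (k - r) = r by omega]
  have hsame1 : SameAt w i j (n + 1) := by
    refine (hi.symm.trans hj0).succ ?_
    by_cases hl : w (i + n) = w (q + n)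
    · exact hl.trans (hij.1 hl).symm
    · exact fin_two_eq_of_ne (Ne.symm hl) (Ne.symm fun h1 => hl (hij.2 h1))
  by_cases hl : w (i + n) = w (q + n)
  · rw [add_comm]
    refine sameAt_of_not_branchAt hsame1 fun r hr hr' hb => ?_
    exact (h.branchAt_iff.1 hb).elim (hno r hr hr') ((hletter i hi hik hno).1 hl r hr hr')
  -- The first visit to the complement of the pivot.
  have hvisit : ∃ r, 1 ≤ r ∧ r < k ∧ OppAt w o (i + r) n := by
    by_contra! h1
    exact hl ((hletter i hi hik hno).2 h1)
  classical
  obtain ⟨l, ⟨hl1, hlk, hlo⟩, hlmin⟩ : ∃ l, (1 ≤ l ∧ l < k ∧ OppAt w o (i + l) n) ∧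
      ∀ r < l, ¬ (1 ≤ r ∧ r < k ∧ OppAt w o (i + r) n) :=
    ⟨Nat.find hvisit, Nat.find_spec hvisit, fun r hr => Nat.find_min hvisit hr⟩
  have hlno : ∀ r, 1 ≤ r → r < l → ¬ BranchAt w (i + r) n := fun r hr hr' hb =>
    (h.branchAt_iff.1 hb).elim (hno r hr (by omega)) fun h1 => hlmin r hr' ⟨hr, by omega, h1⟩
  -- At each visit the next letter tells whether it is the last one.
  have hlast : ∀ p, SameAt w o p n → SameAt w o (p + k) n →
      (∀ r, 1 ≤ r → r < k → ¬ SameAt w o (p + r) n) →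
      ∀ r, 1 ≤ r → r < k → OppAt w o (p + r) n →
        (w (p + r + n) = w (q + n) ↔ r + l = k) := by
    intro p hp hpk hpno
    have fwd : ∀ r, 1 ≤ r → r < k → OppAt w o (p + r) n → w (p + r + n) = w (q + n) →
        r + l = k := by
      intro r hr hr' hopp hlet
      have h1 : OppAt w i (p + r) (n + l) := h.oppAt_of_not_branchAt
        ((hi.symm.trans_oppAt hopp).succ (hlet ▸ hl)) hlno
      have h2 : SameAt w o (p + r + l) n := hlo.trans (h1.shift (by omega))
      have h3 : k ≤ r + l := by
        by_contra! hlt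
        exact hpno (r + l) (by omega) hlt (by rwa [← add_assoc])
      by_contra hne
      refine hlno (k - r) (by omega) (by omega)
        ((h.branchAt_compl_iff (h1.shift (k := k - r) (m := n) (by omega))).2
          (h.branchAt_iff.2 (Or.inl ?_)))
      rwa [show p + r + (k - r) = p + k by omega]
    have step : ∀ r, 1 ≤ r → r < k → OppAt w o (p + r) n → w (p + r + n) ≠ w (q + n) →
        r + m < k ∧ OppAt w o (p + (r + m)) n := by
      intro r hr hr' hopp hlet
      obtain ⟨h1, h2⟩ := loop' _ hopp hlet
      rw [add_assoc] at h1
      refine ⟨?_, h1⟩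
      by_contra! hge
      rcases hge.eq_or_lt with heq | hlt
      · rw [← heq] at h1
        exact h.not_oppAt hpk h1
      · refine h2 (k - r) (by omega) (by omega) (h.branchAt_iff.2 (Or.inl ?_))
        rwa [show p + r + (k - r) = p + k by omega]
    -- From the complement, the way to the pivot consists of loops of length `m ≥ 1` and a final
    -- passage of length `l`. Hence a visit at distance exactly `l` from the end cannot be followed
    -- by another loop.
    have last : ∀ d r, r + d = k → 1 ≤ r → r < k → OppAt w o (p + r) n → r + l ≤ k ∧
        (r + l = k → w (p + r + n) = w (q + n)) := by
      intro d
      induction d using Nat.strong_induction_on with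
      | _ d ih =>
        intro r hd hr hr' hopp
        by_cases hlet : w (p + r + n) = w (q + n)
        · exact ⟨(fwd r hr hr' hopp hlet).le, fun _ => hlet⟩
        · obtain ⟨h1, h2⟩ := step r hr hr' hopp hlet
          have := (ih (d - m) (by omega) (r + m) (by omega) (by omega) h1 h2).1
          exact ⟨by omega, fun h3 => absurd h3 (by omega)⟩
    intro r hr hr' hopp
    exact ⟨fwd r hr hr' hopp, (last (k - r) r (by omega) hr hr' hopp).2⟩
  have main : ∀ r, 1 ≤ r → r ≤ k → SameAt w i j (n + r) := by
    intro r hr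
    induction r, hr using Nat.le_induction with
    | base => exact fun _ => hsame1
    | succ r hr ih =>
      intro hr'
      have h1 := ih (by omega)
      have h2 : SameAt w (i + r) (j + r) n := h1.shift (by omega)
      refine h1.succ ?_
      rw [add_comm n r, ← add_assoc, ← add_assoc]
      by_cases hb : BranchAt w (i + r) n
      · have hopp := (h.branchAt_iff.1 hb).resolve_left (hno r hr (by omega))
        have h3 := hlast i hi hik hno r hr (by omega) hopp
        have h4 := hlast j hj0 hjk hjno r hr (by omega) (hopp.trans_sameAt h2)
        by_cases hr3 : r + l = k
        · exact (h3.2 hr3).trans (h4.2 hr3).symm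
        · exact fin_two_eq_of_ne (Ne.symm fun h5 => hr3 (h3.1 h5))
            (Ne.symm fun h5 => hr3 (h4.1 h5))
      · exact eq_of_not_branchAt hb h2
  rw [add_comm]
  exact main k hk le_rfl

end Pivot
end Returns

/-! ### Returns to arbitrary palindromes and richness. -/

section Richness

variable {w : ℕ → Fin 2} {i j k l m n : ℕ}

theorem sameAt_of_not_branchAt_add (hs : SameAt w i j n) (hb : ∀ r < l, ¬ BranchAt w i (n + r)) :
    SameAt w i j (n + l) := by
  induction l with
  | zero => exact hs
  | succ l ih =>
    have h1 := ih fun r hr => hb r (by omega)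
    exact h1.succ (eq_of_not_branchAt (hb l (by omega)) h1)

/-- If a palindrome can be followed by only one word of length `l`, each of its occurrences is
the centre of a palindrome. -/
theorem RoteLike.palAt_of_not_branchAt (h : RoteLike w) (hp : PalAt w i n)
    (hb : ∀ r < l, ¬ BranchAt w i (n + r)) (hj : SameAt w i (j + l) n) :
    PalAt w j (n + 2 * l) := by
  obtain ⟨q, hq⟩ := h.reversalClosed j (n + 2 * l)
  have h1 : SameAt w (j + l) (q + l) n :=
    (hp.of_sameAt hj).trans (hq.sub (k := l) (k' := l) (by omega))
  -- The reversed window at `q` has the same palindrome in its centre, hence the same `l` forced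
  -- letters after it; these are the mirror image of the `l` letters before the palindrome at `j +
  -- l`.
  have h2 : SameAt w (j + l) (q + l) (n + l) :=
    (sameAt_of_not_branchAt_add hj hb).symm.trans (sameAt_of_not_branchAt_add (hj.trans h1) hb)
  have h3 : ∀ t < n + 2 * l, l ≤ t → w (j + t) = w (j + (n + 2 * l - 1 - t)) := by
    intro t ht hlt
    have h4 := h2 (t - l) (by omega)
    rw [show j + l + (t - l) = j + t by omega, show q + l + (t - l) = q + t by omega] at h4
    rw [h4, hq t ht]
  intro t ht
  by_cases hlt : l ≤ t
  · exact h3 t ht hlt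
  · rw [h3 (n + 2 * l - 1 - t) (by omega) (by omega)]
    congr 1
    omega

/-- The complete returns to a palindrome are palindromes. -/
theorem RoteLike.palAt_return (h : RoteLike w) (hn : 1 ≤ n) (hp : PalAt w i n) (hk : 1 ≤ k)
    (hik : SameAt w i (i + k) n) (hno : ∀ r, 1 ≤ r → r < k → ¬ SameAt w i (i + r) n) :
    PalAt w i (k + n) := by
  -- If every continuation were forced, the suffixes at `i` and `i + k` would be equal.
  have hex : ∃ l, BranchAt w i (n + l) := by
    by_contra! hb
    obtain ⟨j, hj⟩ := h.aperiodic i (i + k) (by omega)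
    have := sameAt_of_not_branchAt_add (l := j + 1) hik fun r _ => hb r
    exact hj (this j (by omega))
  classical
  obtain ⟨l, hl, hb⟩ : ∃ l, BranchAt w i (n + l) ∧ ∀ r < l, ¬ BranchAt w i (n + r) :=
    ⟨Nat.find hex, Nat.find_spec hex, fun r hr => Nat.find_min hex hr⟩
  -- The return is moved to a place with `l` letters before it, so that its palindromes extend by
  -- the forced letters on both sides.
  obtain ⟨s, hs, his⟩ := h.reversalClosed.exists_ge i (k + n + l) l
  obtain ⟨s, rfl⟩ := Nat.exists_eq_add_of_le' hs
  have hpal : ∀ j, SameAt w i (j + l) n → PalAt w j (n + 2 * l) := fun j hj =>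
    h.palAt_of_not_branchAt hp hb hj
  have his0 : SameAt w i (s + l) n := his.mono (by omega)
  have hfull : ∀ j, SameAt w i (j + l) n → SameAt w s j (n + 2 * l) := by
    intro j hj
    have h1 : SameAt w (s + l) (j + l) (n + l) :=
      (sameAt_of_not_branchAt_add his0 hb).symm.trans (sameAt_of_not_branchAt_add hj hb)
    have h2 : ∀ t < n + 2 * l, l ≤ t → w (s + t) = w (j + t) := by
      intro t ht hlt
      have := h1 (t - l) (by omega)
      rwa [show s + l + (t - l) = s + t by omega, show j + l + (t - l) = j + t by omega] at this
    intro t ht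
    by_cases hlt : l ≤ t
    · exact h2 t ht hlt
    · rw [hpal s his0 t ht, hpal j hj t ht]
      exact h2 _ (by omega) (by omega)
  have hbs : BranchAt w s (n + 2 * l) := by
    obtain ⟨r, hr, hne⟩ := hl
    obtain ⟨r', hr', hrr⟩ := h.reversalClosed.exists_ge r (n + l + 1) l
    obtain ⟨r', rfl⟩ := Nat.exists_eq_add_of_le' hr'
    have h1 : SameAt w i (s + l) (n + l) := his.mono (by omega)
    have h2 : SameAt w i (r' + l) (n + l) := hr.trans (hrr.mono (by omega))
    refine BranchAt.of_sameAt (i := s) ?_ (fun _ _ => rfl)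
    by_cases hx : w (s + (n + 2 * l)) = w (i + (n + l))
    · refine ⟨r', hfull r' (h2.mono (by omega)), ?_⟩
      rw [hx, show r' + (n + 2 * l) = r' + l + (n + l) by omega, ← hrr _ (by omega)]
      exact hne
    · obtain ⟨z, hz, hiz⟩ := h.reversalClosed.exists_ge i (n + l + 1) l
      obtain ⟨z, rfl⟩ := Nat.exists_eq_add_of_le' hz
      refine ⟨z, hfull z (hiz.mono (by omega)), ?_⟩
      rwa [show z + (n + 2 * l) = z + l + (n + l) by omega, ← hiz _ (by omega)]
  -- Every occurrence of the palindrome with `l` letters before it is the centre of an occurrence of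
  -- this pivot, so its complete return is that of the pivot with `l` letters cut off at each end.
  have hpivot : Pivot w s (n + 2 * l) := ⟨h, by omega, hpal s his0, hbs⟩
  have hret := hpivot.palAt_return (i := s) (k := k) (fun _ _ => rfl) hk
    (hfull _ (by
      have : SameAt w (i + k) (s + l + k) n := his.shift (by omega)
      rw [show s + k + l = s + l + k by omega]
      exact hik.trans this))
    (fun r hr hr' hsr => hno r hr hr' (by
      have h1 : SameAt w (s + l) (s + r + l) n := hsr.shift (by omega)
      have h2 : SameAt w (i + r) (s + l + r) n := his.shift (by omega)
      rw [show s + r + l = s + l + r by omega] at h1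
      exact (his0.trans h1).trans h2.symm))
  have hsub : PalAt w (s + l) (k + n) := hret.sub (by omega)
  exact hsub.of_sameAt (his.mono (by omega)).symm

theorem palindrome_factorAt_iff : (factorAt w i n).Palindrome ↔ PalAt w i n := by
  rw [List.Palindrome.iff_reverse_eq]
  constructor
  · intro h t ht
    have h1 := congrArg (fun u => u[t]?) h
    simp only [factorAt] at h1
    rw [List.getElem?_reverse (by simpa using ht)] at h1
    have h2 : n - 1 - t < n := by omega
    simpa [ht, h2] using h1.symm
  · intro h
    refine List.ext_getElem (by simp) fun t h1 h2 => ?_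
    rw [length_factorAt] at h2
    have := h t h2
    simp [factorAt, this]

theorem isInfix_factorAt_iff {α : Type*} {w : ℕ → α} {i n : ℕ} {p : List α} :
    p <:+: factorAt w i n ↔ ∃ s, s + p.length ≤ n ∧ p = factorAt w (i + s) p.length := by
  constructor
  · rintro ⟨a, b, h⟩
    have hn : n = a.length + p.length + b.length := by
      rw [← length_factorAt w i n, ← h]; simp [add_assoc]
    refine ⟨a.length, by omega, ?_⟩
    rw [hn, factorAt_add, factorAt_add] at h
    have h1 := List.append_inj h (by simp [length_factorAt])
    exact (List.append_inj h1.1 (by simp [length_factorAt])).2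
  · rintro ⟨s, hs, h⟩
    obtain ⟨d, rfl⟩ := Nat.exists_eq_add_of_le hs
    rw [factorAt_add, factorAt_add, ← h]
    exact ⟨_, _, rfl⟩

theorem mem_palindromicFactors_factorAt_iff {p : List (Fin 2)} :
    p ∈ palindromicFactors (factorAt w i n) ↔
      ∃ s m, 1 ≤ m ∧ s + m ≤ n ∧ PalAt w (i + s) m ∧ p = factorAt w (i + s) m := by
  simp only [palindromicFactors, Set.mem_ofPred_eq, isInfix_factorAt_iff]
  constructor
  · rintro ⟨h1, h2, s, hs, hp⟩
    rw [hp, palindrome_factorAt_iff] at h2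
    exact ⟨s, _, List.length_pos_iff.2 h1, hs, h2, hp⟩
  · rintro ⟨s, m, hm, hs, hp, rfl⟩
    rw [palindrome_factorAt_iff, length_factorAt, ← List.length_pos_iff, length_factorAt]
    exact ⟨hm, hp, s, hs, rfl⟩

/-- A shorter palindromic suffix is also a prefix of the longest one, so it occurred before. If the
longest one had occurred before, the complete return from its previous occurrence would be a longer
palindromic suffix. -/
theorem RoteLike.infRich (h : RoteLike w) : InfRich w := by
  rintro _ ⟨i, n, rfl⟩
  rw [Rich, length_factorAt]
  induction n with
  | zero =>
    rw [Set.ncard_eq_zero (finite_palindromicFactors _), Set.eq_empty_iff_forall_notMem]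
    intro p hp
    obtain ⟨s, m, h1, h2, -⟩ := mem_palindromicFactors_factorAt_iff.1 hp
    omega
  | succ n ih =>
    -- The longest palindromic suffix is the only new palindrome.
    classical
    let P : ℕ → Prop := fun m => PalAt w (i + (n + 1 - m)) m
    have h1 : P 1 := fun t ht => by
      obtain rfl : t = 0 := by omega
      rfl
    have hP : P (Nat.findGreatest P (n + 1)) := Nat.findGreatest_spec (by omega) h1
    have hpos : 1 ≤ Nat.findGreatest P (n + 1) := Nat.le_findGreatest (by omega) h1
    have hle : Nat.findGreatest P (n + 1) ≤ n + 1 := Nat.findGreatest_le _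
    have hmax : ∀ m ≤ n + 1, P m → m ≤ Nat.findGreatest P (n + 1) := fun m hm hPm =>
      Nat.le_findGreatest hm hPm
    generalize Nat.findGreatest P (n + 1) = m at hP hpos hle hmax
    have heq : palindromicFactors (factorAt w i (n + 1)) =
        insert (factorAt w (i + (n + 1 - m)) m) (palindromicFactors (factorAt w i n)) := by
      ext p
      rw [Set.mem_insert_iff, mem_palindromicFactors_factorAt_iff,
        mem_palindromicFactors_factorAt_iff]
      constructor
      · rintro ⟨s, d, hd, hs, hpal, rfl⟩
        by_cases hsd : s + d ≤ n
        · exact Or.inr ⟨s, d, hd, hsd, hpal, rfl⟩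
        obtain rfl : s = n + 1 - d := by omega
        have hdm := hmax d (by omega) hpal
        rcases hdm.eq_or_lt with rfl | hlt
        · exact Or.inl rfl
        have h2 : MirrorAt w (i + (n + 1 - m)) (i + (n + 1 - d)) d := by
          have := hP.sub (k := 0) (k' := m - d) (m := d) (by omega)
          rwa [add_zero, show i + (n + 1 - m) + (m - d) = i + (n + 1 - d) by omega] at this
        have h3 : SameAt w (i + (n + 1 - d)) (i + (n + 1 - m)) d := h2.symm.sameAt_of_palAt hpal
        exact Or.inr ⟨n + 1 - m, d, hd, by omega, hpal.of_sameAt h3, factorAt_eq_factorAt_iff.2 h3⟩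
      · rintro (rfl | ⟨s, d, hd, hs, hpal, rfl⟩)
        · exact ⟨n + 1 - m, m, hpos, by omega, hP, rfl⟩
        · exact ⟨s, d, hd, by omega, hpal, rfl⟩
    have hnotMem : factorAt w (i + (n + 1 - m)) m ∉ palindromicFactors (factorAt w i n) := by
      rw [mem_palindromicFactors_factorAt_iff]
      rintro ⟨s, d, hd, hs, -, hsd⟩
      obtain rfl : m = d := by simpa [length_factorAt] using congrArg List.length hsd
      have hex : ∃ k, 1 ≤ k ∧ k ≤ n + 1 - m ∧
          SameAt w (i + (n + 1 - m - k)) (i + (n + 1 - m)) m :=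
        ⟨n + 1 - m - s, by omega, by omega, by
          rw [Nat.sub_sub_self (by omega)]
          exact (factorAt_eq_factorAt_iff.1 hsd.symm)⟩
      obtain ⟨k, ⟨hk1, hk, hks⟩, hmin⟩ : ∃ k, (1 ≤ k ∧ k ≤ n + 1 - m ∧
          SameAt w (i + (n + 1 - m - k)) (i + (n + 1 - m)) m) ∧ ∀ r < k, ¬ (1 ≤ r ∧
          r ≤ n + 1 - m ∧ SameAt w (i + (n + 1 - m - r)) (i + (n + 1 - m)) m) :=
        ⟨Nat.find hex, Nat.find_spec hex, fun r hr => Nat.find_min hex hr⟩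
      have hret := h.palAt_return (i := i + (n + 1 - m - k)) (k := k) hpos
        (hP.of_sameAt hks.symm) hk1
        (by rwa [show i + (n + 1 - m - k) + k = i + (n + 1 - m) by omega])
        (fun r hr hr' hsr => hmin (k - r) (by omega) ⟨by omega, by omega, by
          rw [show i + (n + 1 - m - (k - r)) = i + (n + 1 - m - k) + r by omega]
          exact hsr.symm.trans hks⟩)
      have := hmax (k + m) (by omega) (by
        show PalAt w (i + (n + 1 - (k + m))) (k + m)
        rwa [show n + 1 - (k + m) = n + 1 - m - k by omega])
      omega
    rw [heq, Set.ncard_insert_of_notMem hnotMem (finite_palindromicFactors _), ih]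

end Richness

/-! ### Prefixes, factors and images under morphisms. -/

section Morphisms

variable {α β γ : Type*} {x y : ℕ → α} {u v l : List α}

/-- The infinite word `x` begins with the finite word `l`. -/
def BeginsWith (x : ℕ → α) (l : List α) : Prop := l = factorAt x 0 l.length

theorem beginsWith_factorAt (x : ℕ → α) (n : ℕ) : BeginsWith x (factorAt x 0 n) := by
  rw [BeginsWith, length_factorAt]

theorem BeginsWith.of_prefix (h : BeginsWith x l) (hu : u <+: l) : BeginsWith x u := by
  rw [BeginsWith]
  refine List.IsPrefix.eq_of_length (l₂ := factorAt x 0 u.length) ?_ (by rw [length_factorAt])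
  refine List.prefix_of_prefix_length_le (l₃ := l) hu ?_ (by rw [length_factorAt])
  rw [h]
  exact factorAt_mono x hu.length_le

theorem BeginsWith.isFactor (h : BeginsWith x l) (hv : v <:+: l) : IsFactor v x := by
  rw [h, isInfix_factorAt_iff] at hv
  obtain ⟨s, -, hs⟩ := hv
  exact ⟨_, _, hs⟩

theorem isFactor_iff_exists_isInfix : IsFactor v x ↔ ∃ m, v <:+: factorAt x 0 m := by
  constructor
  · rintro ⟨i, n, rfl⟩
    refine ⟨i + n, isInfix_factorAt_iff.2 ⟨i, by rw [length_factorAt], ?_⟩⟩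
    rw [length_factorAt, zero_add]
  · rintro ⟨m, hm⟩
    exact (beginsWith_factorAt x m).isFactor hm

theorem IsFactor.of_isInfix (h : IsFactor v x) (hu : u <:+: v) : IsFactor u x := by
  obtain ⟨m, hm⟩ := isFactor_iff_exists_isInfix.1 h
  exact isFactor_iff_exists_isInfix.2 ⟨m, hu.trans hm⟩

theorem IsFactor.exists_append_singleton (h : IsFactor v x) : ∃ a, IsFactor (v ++ [a]) x := by
  obtain ⟨i, hi⟩ := isFactor_iff_exists_eq.1 h
  exact ⟨_, isFactor_append_singleton.2 ⟨i, hi, rfl⟩⟩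

theorem eq_of_beginsWith (h : ∀ m, ∃ l, m < l.length ∧ BeginsWith x l ∧ BeginsWith y l) :
    x = y := by
  funext m
  obtain ⟨l, hm, h1, h2⟩ := h m
  have := factorAt_eq_factorAt_iff.1 (h1.symm.trans h2) m hm
  simpa using this

theorem applyMor_append (φ : α → List β) (u v : List α) :
    applyMor φ (u ++ v) = applyMor φ u ++ applyMor φ v := by
  simp [applyMor]

theorem applyMor_cons (φ : α → List β) (a : α) (v : List α) :
    applyMor φ (a :: v) = φ a ++ applyMor φ v := by
  simp [applyMor]

theorem applyMor_nil (φ : α → List β) : applyMor φ [] = [] := rfl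

theorem applyMor_applyMor (ψ : β → List γ) (φ : α → List β) (u : List α) :
    applyMor ψ (applyMor φ u) = applyMor (fun a => applyMor ψ (φ a)) u := by
  induction u with
  | nil => rfl
  | cons a u ih => rw [applyMor_cons, applyMor_append, ih, applyMor_cons]

theorem applyMor_isInfix (φ : α → List β) (h : u <:+: v) : applyMor φ u <:+: applyMor φ v := by
  obtain ⟨s, t, rfl⟩ := h
  exact ⟨applyMor φ s, applyMor φ t, by simp [applyMor_append]⟩

theorem applyMor_isSuffix (φ : α → List β) (h : u <:+ v) : applyMor φ u <:+ applyMor φ v := by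
  obtain ⟨s, rfl⟩ := h
  exact ⟨applyMor φ s, by simp [applyMor_append]⟩

theorem iterate_applyMor_append (φ : α → List α) (m : ℕ) (u v : List α) :
    (applyMor φ)^[m] (u ++ v) = (applyMor φ)^[m] u ++ (applyMor φ)^[m] v := by
  induction m with
  | zero => rfl
  | succ m ih => rw [Function.iterate_succ_apply', ih, applyMor_append,
      Function.iterate_succ_apply', Function.iterate_succ_apply']

theorem BeginsWith.applyInf [Inhabited β] {φ : α → List β} (hφ : ∀ a, φ a ≠ [])
    (h : BeginsWith x l) : BeginsWith (applyInf φ x) (applyMor φ l) := by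
  rw [h]
  exact applyInf_spec hφ x _

theorem IsFactor.applyInf [Inhabited β] {φ : α → List β} (hφ : ∀ a, φ a ≠ [])
    (h : IsFactor v x) : IsFactor (applyMor φ v) (applyInf φ x) := by
  obtain ⟨m, hm⟩ := isFactor_iff_exists_isInfix.1 h
  exact ((beginsWith_factorAt x m).applyInf hφ).isFactor (applyMor_isInfix φ hm)

theorem exists_isInfix_applyMor [Inhabited β] {φ : α → List β} (hφ : ∀ a, φ a ≠ []) {v : List β}
    (h : IsFactor v (applyInf φ x)) : ∃ m, v <:+: applyMor φ (factorAt x 0 m) := by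
  obtain ⟨m, hm⟩ := isFactor_iff_exists_isInfix.1 h
  refine ⟨m, hm.trans ?_⟩
  rw [applyInf_spec hφ x m]
  refine (factorAt_mono _ ?_).isInfix
  have := le_length_applyMor hφ (factorAt x 0 m)
  rwa [length_factorAt] at this

theorem applyInf_applyInf [Inhabited β] [Inhabited γ] {ψ : β → List γ} {φ : α → List β}
    (hψ : ∀ a, ψ a ≠ []) (hφ : ∀ a, φ a ≠ []) (x : ℕ → α) :
    applyInf ψ (applyInf φ x) = applyInf (fun a => applyMor ψ (φ a)) x := by
  have hψφ : ∀ a, applyMor ψ (φ a) ≠ [] := fun a h => hφ a <| by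
    have := le_length_applyMor hψ (φ a)
    rw [h] at this
    simpa using this
  refine eq_of_beginsWith fun m => ⟨applyMor ψ (applyMor φ (factorAt x 0 (m + 1))), ?_,
    ((beginsWith_factorAt x _).applyInf hφ).applyInf hψ, ?_⟩
  · have h1 := le_length_applyMor hφ (factorAt x 0 (m + 1))
    have h2 := le_length_applyMor hψ (applyMor φ (factorAt x 0 (m + 1)))
    rw [length_factorAt] at h1
    omega
  · rw [applyMor_applyMor]
    exact (beginsWith_factorAt x _).applyInf hψφ

theorem applyInf_fixedPoint [Inhabited α] {φ : α → List α} (hφ : ∀ b, φ b ≠ []) {a : α}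
    {s : List α} (ha : φ a = a :: s) (hs : s ≠ []) :
    applyInf φ (fixedPoint φ a) = fixedPoint φ a := by
  refine eq_of_beginsWith fun m => ⟨(applyMor φ)^[m + 1] [a], ?_, ?_, ?_⟩
  · have := (fixedPoint_spec hφ ha hs (m + 1)).1
    omega
  · rw [Function.iterate_succ_apply']
    exact BeginsWith.applyInf hφ (fixedPoint_spec hφ ha hs m).2
  · exact (fixedPoint_spec hφ ha hs (m + 1)).2

end Morphisms

/-! ### Desubstitution and Sturmian morphisms. -/

section Sturmian

variable {x : ℕ → Fin 2} {s t u v y Y : List (Fin 2)}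

theorem RightSpecial.of_isSuffix (h : RightSpecial x v) (hu : u <:+ v) : RightSpecial x u :=
  fun a => (h a).of_isInfix <| by
    obtain ⟨s, rfl⟩ := hu
    exact ⟨s, [], by simp⟩

/-- A binary word is Sturmian if its right special factors are the suffixes of a left infinite
word. -/
theorem isSturmian_of_rightSpecial (hlong : ∀ n, ∃ v, n ≤ v.length ∧ RightSpecial x v)
    (hchain : ∀ u v, RightSpecial x u → RightSpecial x v → u.length ≤ v.length → u <:+ v) :
    IsSturmian x := by
  refine isSturmian_of_existsUnique fun n => ?_
  obtain ⟨v, hn, hv⟩ := hlong n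
  refine ⟨v.drop (v.length - n), ⟨by rw [List.length_drop]; omega,
    hv.of_isSuffix (List.drop_suffix _ _)⟩, ?_⟩
  rintro u ⟨hu, hru⟩
  have h1 := hchain u v hru hv (by omega)
  refine (List.suffix_of_suffix_length_le h1 (List.drop_suffix _ _) ?_).eq_of_length ?_ <;>
  · rw [List.length_drop]; omega

/-- `0 ↦ 01`, `1 ↦ 1`. -/
def morD : Fin 2 → List (Fin 2) := ![[0, 1], [1]]

/-- The Fibonacci morphism `0 ↦ 01`, `1 ↦ 0`. -/
def morFib : Fin 2 → List (Fin 2) := ![[0, 1], [0]]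

theorem morD_ne_nil : ∀ a, morD a ≠ [] := by decide

theorem morFib_ne_nil : ∀ a, morFib a ≠ [] := by decide

theorem applyMor_morD_zero_cons (u : List (Fin 2)) :
    applyMor morD (0 :: u) = 0 :: 1 :: applyMor morD u := applyMor_cons _ _ _

theorem applyMor_morD_one_cons (u : List (Fin 2)) :
    applyMor morD (1 :: u) = 1 :: applyMor morD u := applyMor_cons _ _ _

theorem applyMor_morFib_zero_cons (u : List (Fin 2)) :
    applyMor morFib (0 :: u) = 0 :: 1 :: applyMor morFib u := applyMor_cons _ _ _

theorem applyMor_morFib_one_cons (u : List (Fin 2)) :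
    applyMor morFib (1 :: u) = 0 :: applyMor morFib u := applyMor_cons _ _ _

theorem fin_two_cases {P : Fin 2 → Prop} (a : Fin 2) (h0 : P 0) (h1 : P 1) : P a := by
  fin_cases a <;> assumption

theorem morD_split_zero (h : s ++ 0 :: t = applyMor morD Y) :
    ∃ Y₁ Y₂, Y = Y₁ ++ 0 :: Y₂ ∧ s = applyMor morD Y₁ := by
  induction Y generalizing s with
  | nil => simp [applyMor_nil] at h
  | cons a Y ih =>
    induction a using fin_two_cases with
    | h0 =>
      rw [applyMor_morD_zero_cons] at h
      match s, h with
      | [], h => exact ⟨[], Y, rfl, rfl⟩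
      | [_], h => simp at h
      | b :: c :: s, h =>
        simp only [List.cons_append, List.cons.injEq] at h
        obtain ⟨rfl, rfl, h⟩ := h
        obtain ⟨Y₁, Y₂, rfl, rfl⟩ := ih h
        exact ⟨0 :: Y₁, Y₂, rfl, (applyMor_morD_zero_cons _).symm⟩
    | h1 =>
      rw [applyMor_morD_one_cons] at h
      match s, h with
      | [], h => simp at h
      | b :: s, h =>
        simp only [List.cons_append, List.cons.injEq] at h
        obtain ⟨rfl, h⟩ := h
        obtain ⟨Y₁, Y₂, rfl, rfl⟩ := ih h
        exact ⟨1 :: Y₁, Y₂, rfl, (applyMor_morD_one_cons _).symm⟩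

/-- The second letter of `11` cannot end the block `01`, so it is a block by itself and a cut lies
before it. -/
theorem morD_split_one (h : s ++ 1 :: 1 :: t = applyMor morD Y) :
    ∃ Y₁ Y₂, Y = Y₁ ++ 1 :: Y₂ ∧ s ++ [1] = applyMor morD Y₁ := by
  induction Y generalizing s with
  | nil => simp [applyMor_nil] at h
  | cons a Y ih =>
    induction a using fin_two_cases with
    | h0 =>
      rw [applyMor_morD_zero_cons] at h
      match s, h with
      | [], h => simp at h
      | [b], h =>
        simp only [List.cons_append, List.nil_append, List.cons.injEq, true_and] at h
        obtain ⟨rfl, h⟩ := h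
        rcases Y with _ | ⟨c, Y⟩
        · simp [applyMor_nil] at h
        · induction c using fin_two_cases with
          | h0 => rw [applyMor_morD_zero_cons] at h; simp at h
          | h1 => exact ⟨[0], Y, rfl, rfl⟩
      | b :: c :: s, h =>
        simp only [List.cons_append, List.cons.injEq] at h
        obtain ⟨rfl, rfl, h⟩ := h
        obtain ⟨Y₁, Y₂, rfl, h2⟩ := ih h
        exact ⟨0 :: Y₁, Y₂, rfl, by rw [applyMor_morD_zero_cons, ← h2]; rfl⟩
    | h1 =>
      rw [applyMor_morD_one_cons] at h
      match s, h with
      | [], h =>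
        simp only [List.nil_append, List.cons.injEq, true_and] at h
        rcases Y with _ | ⟨c, Y⟩
        · simp [applyMor_nil] at h
        · induction c using fin_two_cases with
          | h0 => rw [applyMor_morD_zero_cons] at h; simp at h
          | h1 => exact ⟨[1], Y, rfl, rfl⟩
      | b :: s, h =>
        simp only [List.cons_append, List.cons.injEq] at h
        obtain ⟨rfl, h⟩ := h
        obtain ⟨Y₁, Y₂, rfl, h2⟩ := ih h
        exact ⟨1 :: Y₁, Y₂, rfl, by rw [applyMor_morD_one_cons, ← h2]; rfl⟩

/-- A leading `1` is detached whether it ends a block `01` or is a block `1`; the first letter of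
`v` then decides which form applies, and `y` is determined by `v`. -/
theorem morD_isSuffix (h : v <:+ applyMor morD Y) :
    ∃ y, y <:+ Y ∧ ((v = applyMor morD y ∧ v.head? ≠ some 1) ∨ v = 1 :: applyMor morD y) := by
  induction Y with
  | nil =>
    obtain rfl : v = [] := by simpa [applyMor_nil] using h
    exact ⟨[], List.suffix_rfl, Or.inl ⟨rfl, by simp⟩⟩
  | cons a Y ih =>
    induction a using fin_two_cases with
    | h0 =>
      rw [applyMor_morD_zero_cons, List.suffix_cons_iff, List.suffix_cons_iff] at h
      rcases h with rfl | rfl | h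
      · exact ⟨0 :: Y, List.suffix_rfl, Or.inl ⟨(applyMor_morD_zero_cons _).symm, by simp⟩⟩
      · exact ⟨Y, List.suffix_cons _ _, Or.inr rfl⟩
      · obtain ⟨y, hy, h⟩ := ih h
        exact ⟨y, hy.trans (List.suffix_cons _ _), h⟩
    | h1 =>
      rw [applyMor_morD_one_cons, List.suffix_cons_iff] at h
      rcases h with rfl | h
      · exact ⟨Y, List.suffix_cons _ _, Or.inr rfl⟩
      · obtain ⟨y, hy, h⟩ := ih h
        exact ⟨y, hy.trans (List.suffix_cons _ _), h⟩

/-- A leading `1` can only end the block `01`, so the preimage is known to continue to the left with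
`0`. -/
theorem morFib_isSuffix (h : v <:+ applyMor morFib Y) :
    ∃ y, y <:+ Y ∧ ((v = applyMor morFib y ∧ v.head? ≠ some 1) ∨
      (v = 1 :: applyMor morFib y ∧ 0 :: y <:+ Y)) := by
  induction Y with
  | nil =>
    obtain rfl : v = [] := by simpa [applyMor_nil] using h
    exact ⟨[], List.suffix_rfl, Or.inl ⟨rfl, by simp⟩⟩
  | cons a Y ih =>
    have ih' : v <:+ applyMor morFib Y → ∃ y, y <:+ a :: Y ∧ ((v = applyMor morFib y ∧
        v.head? ≠ some 1) ∨ (v = 1 :: applyMor morFib y ∧ 0 :: y <:+ a :: Y)) := by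
      intro h
      obtain ⟨y, hy, h⟩ := ih h
      exact ⟨y, hy.trans (List.suffix_cons _ _), h.imp id fun h =>
        ⟨h.1, h.2.trans (List.suffix_cons _ _)⟩⟩
    induction a using fin_two_cases with
    | h0 =>
      rw [applyMor_morFib_zero_cons, List.suffix_cons_iff, List.suffix_cons_iff] at h
      rcases h with rfl | rfl | h
      · exact ⟨0 :: Y, List.suffix_rfl, Or.inl ⟨(applyMor_morFib_zero_cons _).symm, by simp⟩⟩
      · exact ⟨Y, List.suffix_cons _ _, Or.inr ⟨rfl, List.suffix_rfl⟩⟩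
      · exact ih' h
    | h1 =>
      rw [applyMor_morFib_one_cons, List.suffix_cons_iff] at h
      rcases h with rfl | h
      · exact ⟨1 :: Y, List.suffix_rfl, Or.inl ⟨(applyMor_morFib_one_cons _).symm, by simp⟩⟩
      · exact ih' h

theorem morFib_head (Y : List (Fin 2)) : (applyMor morFib Y).head? ≠ some 1 := by
  rcases Y with _ | ⟨a, Y⟩
  · simp [applyMor_nil]
  · induction a using fin_two_cases with
    | h0 => rw [applyMor_morFib_zero_cons]; simp
    | h1 => rw [applyMor_morFib_one_cons]; simp

theorem morD_injective : Function.Injective (applyMor morD) := by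
  intro u v h
  induction u generalizing v with
  | nil =>
    rcases v with _ | ⟨a, v⟩
    · rfl
    · induction a using fin_two_cases with
      | h0 => rw [applyMor_morD_zero_cons] at h; simp [applyMor_nil] at h
      | h1 => rw [applyMor_morD_one_cons] at h; simp [applyMor_nil] at h
  | cons a u ih =>
    rcases v with _ | ⟨b, v⟩
    · induction a using fin_two_cases with
      | h0 => rw [applyMor_morD_zero_cons] at h; simp [applyMor_nil] at h
      | h1 => rw [applyMor_morD_one_cons] at h; simp [applyMor_nil] at h
    · induction a using fin_two_cases <;> induction b using fin_two_cases <;>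
        simp only [applyMor_morD_zero_cons, applyMor_morD_one_cons, List.cons.injEq, true_and,
          zero_ne_one, one_ne_zero, false_and] at h
      all_goals rw [ih h]

theorem morFib_injective : Function.Injective (applyMor morFib) := by
  intro u v h
  induction u generalizing v with
  | nil =>
    rcases v with _ | ⟨a, v⟩
    · rfl
    · induction a using fin_two_cases with
      | h0 => rw [applyMor_morFib_zero_cons] at h; simp [applyMor_nil] at h
      | h1 => rw [applyMor_morFib_one_cons] at h; simp [applyMor_nil] at h
  | cons a u ih =>
    rcases v with _ | ⟨b, v⟩
    · induction a using fin_two_cases with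
      | h0 => rw [applyMor_morFib_zero_cons] at h; simp [applyMor_nil] at h
      | h1 => rw [applyMor_morFib_one_cons] at h; simp [applyMor_nil] at h
    · induction a using fin_two_cases <;> induction b using fin_two_cases <;>
        simp only [applyMor_morFib_zero_cons, applyMor_morFib_one_cons, List.cons.injEq,
          true_and] at h
      · rw [ih h]
      · exact absurd (h ▸ rfl) (morFib_head v)
      · exact absurd (h ▸ rfl) (morFib_head u)
      · rw [ih h]

theorem morFib_split_one (h : s ++ 1 :: t = applyMor morFib Y) :
    ∃ Y₁ Y₂, Y = Y₁ ++ 0 :: Y₂ ∧ s = applyMor morFib Y₁ ++ [0] := by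
  induction Y generalizing s with
  | nil => simp [applyMor_nil] at h
  | cons a Y ih =>
    induction a using fin_two_cases with
    | h0 =>
      rw [applyMor_morFib_zero_cons] at h
      match s, h with
      | [], h => simp at h
      | [b], h =>
        simp only [List.cons_append, List.nil_append, List.cons.injEq] at h
        obtain ⟨rfl, -⟩ := h
        exact ⟨[], Y, rfl, rfl⟩
      | b :: c :: s, h =>
        simp only [List.cons_append, List.cons.injEq] at h
        obtain ⟨rfl, rfl, h⟩ := h
        obtain ⟨Y₁, Y₂, rfl, rfl⟩ := ih h
        exact ⟨0 :: Y₁, Y₂, rfl, by rw [applyMor_morFib_zero_cons]; rfl⟩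
    | h1 =>
      rw [applyMor_morFib_one_cons] at h
      match s, h with
      | [], h => simp at h
      | b :: s, h =>
        simp only [List.cons_append, List.cons.injEq] at h
        obtain ⟨rfl, h⟩ := h
        obtain ⟨Y₁, Y₂, rfl, rfl⟩ := ih h
        exact ⟨1 :: Y₁, Y₂, rfl, by rw [applyMor_morFib_one_cons]; rfl⟩

theorem morFib_split_zero (h : s ++ 0 :: 0 :: t = applyMor morFib Y) :
    ∃ Y₁ Y₂, Y = Y₁ ++ 1 :: Y₂ ∧ s = applyMor morFib Y₁ := by
  induction Y generalizing s with
  | nil => simp [applyMor_nil] at h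
  | cons a Y ih =>
    induction a using fin_two_cases with
    | h0 =>
      rw [applyMor_morFib_zero_cons] at h
      match s, h with
      | [], h => simp at h
      | [b], h => simp at h
      | b :: c :: s, h =>
        simp only [List.cons_append, List.cons.injEq] at h
        obtain ⟨rfl, rfl, h⟩ := h
        obtain ⟨Y₁, Y₂, rfl, rfl⟩ := ih h
        exact ⟨0 :: Y₁, Y₂, rfl, by rw [applyMor_morFib_zero_cons]⟩
    | h1 =>
      rw [applyMor_morFib_one_cons] at h
      match s, h with
      | [], h => exact ⟨[], Y, rfl, rfl⟩
      | b :: s, h =>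
        simp only [List.cons_append, List.cons.injEq] at h
        obtain ⟨rfl, h⟩ := h
        obtain ⟨Y₁, Y₂, rfl, rfl⟩ := ih h
        exact ⟨1 :: Y₁, Y₂, rfl, by rw [applyMor_morFib_one_cons]⟩

theorem exists_one_cons_morD_eq (z : List (Fin 2)) : ∃ r, 1 :: applyMor morD z = r ++ [1] := by
  rcases z.eq_nil_or_concat with rfl | ⟨z, a, rfl⟩
  · exact ⟨[], rfl⟩
  · rw [List.concat_eq_append, applyMor_append]
    induction a using fin_two_cases with
    | h0 => exact ⟨1 :: applyMor morD z ++ [0], by simp [applyMor, morD]⟩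
    | h1 => exact ⟨1 :: applyMor morD z, by simp [applyMor, morD]⟩

/-- Both blocks end in `1`, so the block before the image of `u` supplies the detached `1`. -/
theorem one_cons_morD_isSuffix (h : u <:+ v) :
    1 :: applyMor morD u <:+ 1 :: applyMor morD v := by
  obtain ⟨z, rfl⟩ := h
  obtain ⟨r, hr⟩ := exists_one_cons_morD_eq z
  refine ⟨r, ?_⟩
  rw [applyMor_append, ← List.cons_append, hr]
  simp

theorem isFactor_of_isSuffix {Y₁ Y₂ : List (Fin 2)} {a : Fin 2} {m : ℕ} (hy : y <:+ Y₁)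
    (h : factorAt x 0 m = Y₁ ++ a :: Y₂) : IsFactor (y ++ [a]) x := by
  refine (beginsWith_factorAt x m).isFactor ?_
  obtain ⟨z, rfl⟩ := hy
  exact ⟨z, Y₂, by rw [h]; simp⟩

/-- Followed by `0`, the word `v` ends with a block, hence in `1`; followed by `1`, it then ends in
front of a block `1`. Both occurrences are cut at the end of `v` and decompose alike from the right.
-/
theorem RightSpecial.exists_of_morD (h : RightSpecial (applyInf morD x) v) (hv : v ≠ []) :
    ∃ y, RightSpecial x y ∧ y.length ≤ v.length ∧ v <:+ 1 :: applyMor morD y := by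
  obtain ⟨m, s, t, hm⟩ := exists_isInfix_applyMor morD_ne_nil (h 0)
  obtain ⟨Y₁, Y₂, hY, hs⟩ := morD_split_zero (s := s ++ v) (t := t) (by simpa using hm)
  have hv1 : v <:+ applyMor morD Y₁ := ⟨s, hs⟩
  obtain ⟨v', rfl⟩ : ∃ v', v = v' ++ [1] := by
    obtain ⟨r, hr⟩ := exists_one_cons_morD_eq Y₁
    have h1 : v <:+ r ++ [1] := hr ▸ hv1.trans (List.suffix_cons _ _)
    rcases List.suffix_concat_iff.1 h1 with h2 | ⟨v', h2, -⟩
    exacts [absurd h2 hv, ⟨v', h2⟩]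
  obtain ⟨m', s', t', hm'⟩ := exists_isInfix_applyMor morD_ne_nil (h 1)
  obtain ⟨Y₁', Y₂', hY', hs'⟩ := morD_split_one (s := s' ++ v') (t := t') (by simpa using hm')
  have hv2 : v' ++ [1] <:+ applyMor morD Y₁' := ⟨s', by simpa using hs'⟩
  obtain ⟨y, hy, h1⟩ := morD_isSuffix hv1
  obtain ⟨y', hy', h2⟩ := morD_isSuffix hv2
  obtain rfl : y = y' := by
    rcases h1 with ⟨h1, h3⟩ | h1 <;> rcases h2 with ⟨h2, h4⟩ | h2
    · exact morD_injective (h1.symm.trans h2)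
    · exact absurd (by rw [h2]; rfl) h3
    · exact absurd (by rw [h1]; rfl) h4
    · exact morD_injective (List.cons.inj (h1.symm.trans h2)).2
  refine ⟨y, ?_, ?_, ?_⟩
  · intro a
    induction a using fin_two_cases with
    | h0 => exact isFactor_of_isSuffix hy hY
    | h1 => exact isFactor_of_isSuffix hy' hY'
  · have := le_length_applyMor morD_ne_nil y
    rcases h1 with ⟨h1, -⟩ | h1 <;> rw [h1]
    · exact this
    · rw [List.length_cons]; omega
  · rcases h1 with ⟨h1, -⟩ | h1 <;> rw [h1]
    exact List.suffix_cons _ _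

theorem RightSpecial.morD (h : RightSpecial x y) :
    RightSpecial (applyInf morD x) (applyMor morD y) := by
  intro a
  refine ((h a).applyInf morD_ne_nil).of_isInfix ?_
  rw [applyMor_append]
  induction a using fin_two_cases with
  | h0 => exact ⟨[], [1], by simp [applyMor, RichWords.morD]⟩
  | h1 => exact ⟨[], [], by simp [applyMor, RichWords.morD]⟩

/-- The last letter of `v` is a `0` that begins the block `01` in one occurrence and is the block
`0` in the other, so both are cut before it. This undecided `0` makes the preimage strictly shorter.
-/
theorem RightSpecial.exists_of_morFib (h : RightSpecial (applyInf morFib x) v) (hv : v ≠ []) :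
    ∃ y, RightSpecial x y ∧ y.length < v.length ∧ v <:+ applyMor morFib y ++ [0] := by
  obtain ⟨m, s, t, hm⟩ := exists_isInfix_applyMor morFib_ne_nil (h 1)
  obtain ⟨Y₁, Y₂, hY, hs⟩ := morFib_split_one (s := s ++ v) (t := t) (by simpa using hm)
  obtain ⟨v', rfl, hv1⟩ : ∃ v', v = v' ++ [0] ∧ v' <:+ applyMor morFib Y₁ := by
    have h1 : v <:+ applyMor morFib Y₁ ++ [0] := ⟨s, hs⟩
    exact (List.suffix_concat_iff.1 h1).resolve_left hv
  obtain ⟨m', s', t', hm'⟩ := exists_isInfix_applyMor morFib_ne_nil (h 0)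
  obtain ⟨Y₁', Y₂', hY', hs'⟩ := morFib_split_zero (s := s' ++ v') (t := t') (by simpa using hm')
  have hv2 : v' <:+ applyMor morFib Y₁' := ⟨s', hs'⟩
  obtain ⟨y, hy, h1⟩ := morFib_isSuffix hv1
  obtain ⟨y', hy', h2⟩ := morFib_isSuffix hv2
  have hlen := le_length_applyMor morFib_ne_nil y
  have hrs : ∀ z, z <:+ Y₁ → z <:+ Y₁' → RightSpecial x z := by
    intro z hz hz' a
    induction a using fin_two_cases with
    | h0 => exact isFactor_of_isSuffix hz hY
    | h1 => exact isFactor_of_isSuffix hz' hY'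
  rcases h1 with ⟨h1, h3⟩ | ⟨h1, h3⟩ <;> rcases h2 with ⟨h2, h4⟩ | ⟨h2, h4⟩
  · obtain rfl := morFib_injective (h1.symm.trans h2)
    refine ⟨y, hrs y hy hy', ?_, by rw [h1]⟩
    rw [h1, List.length_append, List.length_singleton]
    omega
  · exact absurd (by rw [h2]; rfl) h3
  · exact absurd (by rw [h1]; rfl) h4
  · obtain rfl := morFib_injective (List.cons.inj (h1.symm.trans h2)).2
    refine ⟨0 :: y, hrs _ h3 h4, ?_, ?_⟩
    · rw [h1, List.length_append, List.length_cons, List.length_cons, List.length_singleton]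
      omega
    · rw [h1, applyMor_morFib_zero_cons]
      exact List.suffix_cons _ _

theorem RightSpecial.morFib (h : RightSpecial x y) :
    RightSpecial (applyInf morFib x) (applyMor morFib y ++ [0]) := by
  intro a
  induction a using fin_two_cases with
  | h0 =>
    -- The second `0` is the first letter of the next block, whichever letter `c` follows.
    obtain ⟨c, hc⟩ := (h 1).exists_append_singleton
    refine (hc.applyInf morFib_ne_nil).of_isInfix ?_
    rw [applyMor_append, applyMor_append]
    induction c using fin_two_cases with
    | h0 => exact ⟨[], [1], by simp [applyMor, RichWords.morFib]⟩
    | h1 => exact ⟨[], [], by simp [applyMor, RichWords.morFib]⟩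
  | h1 =>
    refine ((h 0).applyInf morFib_ne_nil).of_isInfix ?_
    rw [applyMor_append]
    exact ⟨[], [], by simp [applyMor, RichWords.morFib]⟩

theorem IsSturmian.rightSpecial_isSuffix (h : IsSturmian x) (hu : RightSpecial x u)
    (hv : RightSpecial x v) (hl : u.length ≤ v.length) : u <:+ v := by
  obtain ⟨w, hw⟩ := Set.ncard_eq_one.1 (ncard_rightSpecial_of_isSturmian h u.length)
  have key : ∀ z : List (Fin 2), z.length = u.length → RightSpecial x z → z = w := fun z h1 h2 => by
    have : z ∈ {v : List (Fin 2) | v.length = u.length ∧ RightSpecial x v} := ⟨h1, h2⟩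
    rwa [hw] at this
  have h1 := List.drop_suffix (v.length - u.length) v
  rwa [key _ (by rw [List.length_drop]; omega) (hv.of_isSuffix h1), ← key u rfl hu] at h1

/-- The morphism `0 ↦ 01`, `1 ↦ 1` preserves Sturmian words. -/
theorem IsSturmian.applyInf_morD (h : IsSturmian x) : IsSturmian (applyInf morD x) := by
  refine isSturmian_of_rightSpecial (fun n => ?_) fun u v hu hv hl => ?_
  · obtain ⟨i, -, hi⟩ := h.aperiodic.exists_branchAt_ge 0 n
    refine ⟨_, ?_, (rightSpecial_factorAt_iff.2 hi).morD⟩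
    have := le_length_applyMor morD_ne_nil (factorAt x i n)
    rwa [length_factorAt] at this
  · rcases eq_or_ne u [] with rfl | hu0
    · exact List.nil_suffix
    have hv0 : v ≠ [] := by rintro rfl; simp_all
    obtain ⟨y, hy, -, hyu⟩ := hu.exists_of_morD hu0
    obtain ⟨z, hz, -, hzv⟩ := hv.exists_of_morD hv0
    rcases le_total y.length z.length with h1 | h1
    · exact List.suffix_of_suffix_length_le
        (hyu.trans (one_cons_morD_isSuffix (h.rightSpecial_isSuffix hy hz h1))) hzv hl
    · exact List.suffix_of_suffix_length_le hyu
        (hzv.trans (one_cons_morD_isSuffix (h.rightSpecial_isSuffix hz hy h1))) hl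

/-- A fixed point of the composition of the morphisms `0 ↦ 01, 1 ↦ 1` and `0 ↦ 01, 1 ↦ 0` is
Sturmian if both letters occur in it. -/
theorem isSturmian_of_fixed (hx : applyInf morD (applyInf morFib x) = x)
    (h0 : RightSpecial x []) : IsSturmian x := by
  -- Undoing both morphisms leads to a strictly shorter right special factor of the same word, so
  -- the suffix order of right special factors follows by induction on length.
  have back : ∀ v, RightSpecial x v → v ≠ [] → ∃ y, RightSpecial x y ∧ y.length < v.length ∧
      v <:+ 1 :: applyMor morD (applyMor morFib y ++ [0]) := by
    intro v hv hv0
    rw [← hx] at hv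
    obtain ⟨z, hz, hlz, hvz⟩ := hv.exists_of_morD hv0
    rcases eq_or_ne z [] with rfl | hz0
    · exact ⟨[], h0, List.length_pos_iff.2 hv0,
        hvz.trans (one_cons_morD_isSuffix List.nil_suffix)⟩
    · obtain ⟨y, hy, hly, hzy⟩ := hz.exists_of_morFib hz0
      exact ⟨y, hy, by omega, hvz.trans (one_cons_morD_isSuffix hzy)⟩
  have mono : ∀ {y z : List (Fin 2)}, y <:+ z →
      1 :: applyMor morD (applyMor morFib y ++ [0]) <:+
        1 :: applyMor morD (applyMor morFib z ++ [0]) := by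
    intro y z hyz
    obtain ⟨r, hr⟩ := applyMor_isSuffix morFib hyz
    exact one_cons_morD_isSuffix ⟨r, by rw [← hr]; simp⟩
  refine isSturmian_of_rightSpecial (fun n => ?_) ?_
  · induction n with
    | zero => exact ⟨[], le_rfl, h0⟩
    | succ n ih =>
      obtain ⟨v, hv, hr⟩ := ih
      refine ⟨applyMor morD (applyMor morFib v ++ [0]), ?_, hx ▸ hr.morFib.morD⟩
      have h1 := le_length_applyMor morFib_ne_nil v
      have h2 := le_length_applyMor morD_ne_nil (applyMor morFib v ++ [0])
      rw [List.length_append, List.length_singleton] at h2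
      omega
  · have key : ∀ n u v, v.length ≤ n → RightSpecial x u → RightSpecial x v →
        u.length ≤ v.length → u <:+ v := by
      intro n
      induction n with
      | zero =>
        intro u v hn _ _ hl
        obtain rfl := List.length_eq_zero_iff.1 (show u.length = 0 by omega)
        exact List.nil_suffix
      | succ n ih =>
        intro u v hn hu hv hl
        rcases eq_or_ne u [] with rfl | hu0
        · exact List.nil_suffix
        have hv0 : v ≠ [] := by rintro rfl; simp_all
        obtain ⟨y, hy, hly, hyu⟩ := back u hu hu0
        obtain ⟨z, hz, hlz, hzv⟩ := back v hv hv0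
        rcases le_total y.length z.length with h1 | h1
        · exact List.suffix_of_suffix_length_le
            (hyu.trans (mono (ih y z (by omega) hy hz h1))) hzv hl
        · exact List.suffix_of_suffix_length_le hyu
            (hzv.trans (mono (ih z y (by omega) hz hy h1))) hl
    exact fun u v => key v.length u v le_rfl

end Sturmian

/-! ### The words of the theorem. -/

section Main

/-- `0 ↦ 0`, `1 ↦ 11`, `2 ↦ 101`: the first differences of the images under `morF`. -/
def morA : Fin 3 → List (Fin 2) := ![[0], [1, 1], [1, 0, 1]]

theorem morA_ne_nil : ∀ a, morA a ≠ [] := by decide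

theorem morF_ne_nil : ∀ a, morF a ≠ [] := by decide

theorem morG_ne_nil : ∀ a, morG a ≠ [] := by decide

theorem morH_ne_nil : ∀ a, morH a ≠ [] := by decide

theorem morXi_ne_nil : ∀ a, morXi a ≠ [] := by decide

theorem morEta_ne_nil : ∀ a, morEta a ≠ [] := by decide

theorem morD_morFib : (fun a => applyMor morD (morFib a)) = morXi := by decide

theorem morD_morD : (fun a => applyMor morD (morD a)) = morEta := by decide

theorem morA_morH : (fun a => applyMor morA (morH a)) = fun a => applyMor morXi (morA a) := by
  decide

theorem morA_morG : (fun a => applyMor morA (morG a)) =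
    fun a => applyMor (fun b => applyMor morEta (morXi b)) (morA a) := by
  decide

/-- The first differences of a finite word. -/
def diffs (l : List (Fin 2)) : List (Fin 2) := List.zipWith (· + ·) l l.tail

theorem BeginsWith.firstDiff {w : ℕ → Fin 2} {l : List (Fin 2)} (h : BeginsWith w l) :
    BeginsWith (firstDiff w) (diffs l) := by
  rw [BeginsWith]
  refine List.ext_getElem (by rw [length_factorAt]) fun n h1 h2 => ?_
  have hn : n + 1 < l.length := by
    simp only [diffs, List.length_zipWith, List.length_tail] at h1
    omega
  have key : ∀ k (hk : k < l.length), l[k] = w k := by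
    intro k hk
    have := congrArg (fun u => u[k]?) h
    simpa [factorAt, hk] using this
  simp [diffs, factorAt, RichWords.firstDiff, key]

/-- Every block of `morF` begins with `0`; the appended `0` stands for the start of the next block
and supplies the last difference. -/
theorem diffs_applyMor_morF (l : List (Fin 3)) :
    diffs (applyMor morF l ++ [0]) = applyMor morA l := by
  induction l with
  | nil => rfl
  | cons a l ih =>
    obtain ⟨r, hr⟩ : ∃ r, applyMor morF l ++ [0] = 0 :: r := by
      rcases l with _ | ⟨b, l⟩
      · exact ⟨[], rfl⟩
      · rw [applyMor_cons]
        fin_cases b <;> exact ⟨_, rfl⟩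
    rw [applyMor_cons, applyMor_cons, ← ih, List.append_assoc, hr]
    fin_cases a <;> simp [diffs, morF, morA]

theorem firstDiff_applyInf_morF (x : ℕ → Fin 3) :
    firstDiff (applyInf morF x) = applyInf morA x := by
  refine eq_of_beginsWith fun m => ⟨applyMor morA (factorAt x 0 (m + 1)), ?_, ?_,
    (beginsWith_factorAt x _).applyInf morA_ne_nil⟩
  · have := le_length_applyMor morA_ne_nil (factorAt x 0 (m + 1))
    rw [length_factorAt] at this
    omega
  · rw [← diffs_applyMor_morF]
    refine BeginsWith.firstDiff (((beginsWith_factorAt x (m + 2)).applyInf morF_ne_nil).of_prefix ?_)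
    rw [factorAt_succ x 0 (m + 1), applyMor_append]
    generalize x (0 + (m + 1)) = a
    refine (List.prefix_append_right_inj _).2 ?_
    fin_cases a
    exacts [⟨[], rfl⟩, ⟨[1], rfl⟩, ⟨[1, 1], rfl⟩]

theorem fixedPoint_morH_spec (m : ℕ) : m < ((applyMor morH)^[m] [0]).length ∧
    BeginsWith (fixedPoint morH 0) ((applyMor morH)^[m] [0]) :=
  fixedPoint_spec morH_ne_nil (a := 0) (s := [1]) rfl (by simp) m

theorem fixedPoint_morXi_spec (m : ℕ) : m < ((applyMor morXi)^[m] [0]).length ∧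
    BeginsWith (fixedPoint morXi 0) ((applyMor morXi)^[m] [0]) :=
  fixedPoint_spec morXi_ne_nil (a := 0) (s := [1, 1]) rfl (by simp) m

theorem applyInf_morXi_fixedPoint : applyInf morXi (fixedPoint morXi 0) = fixedPoint morXi 0 :=
  applyInf_fixedPoint morXi_ne_nil rfl (by simp)

theorem applyInf_morA_fixedPoint : applyInf morA (fixedPoint morH 0) = fixedPoint morXi 0 := by
  have key : ∀ m, applyMor morA ((applyMor morH)^[m] [0]) = (applyMor morXi)^[m] [0] := by
    intro m
    induction m with
    | zero => rfl
    | succ m ih =>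
      rw [Function.iterate_succ_apply', Function.iterate_succ_apply', ← ih, applyMor_applyMor,
        applyMor_applyMor, morA_morH]
  refine eq_of_beginsWith fun m => ⟨(applyMor morXi)^[m] [0], (fixedPoint_morXi_spec m).1, ?_,
    (fixedPoint_morXi_spec m).2⟩
  rw [← key]
  exact BeginsWith.applyInf morA_ne_nil (fixedPoint_morH_spec m).2

theorem firstDiff_wordFH : firstDiff wordFH = fixedPoint morXi 0 :=
  (firstDiff_applyInf_morF _).trans applyInf_morA_fixedPoint

theorem firstDiff_wordFGH : firstDiff wordFGH = applyInf morEta (fixedPoint morXi 0) := by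
  have h1 : ∀ a, applyMor morEta (morXi a) ≠ [] := by decide
  rw [wordFGH, firstDiff_applyInf_morF, applyInf_applyInf morA_ne_nil morG_ne_nil, morA_morG,
    ← applyInf_applyInf h1 morA_ne_nil, ← applyInf_applyInf morEta_ne_nil morXi_ne_nil,
    applyInf_morA_fixedPoint, applyInf_morXi_fixedPoint]

theorem isSturmian_fixedPoint_morXi : IsSturmian (fixedPoint morXi 0) := by
  refine isSturmian_of_fixed ?_ fun a => ?_
  · rw [applyInf_applyInf morD_ne_nil morFib_ne_nil, morD_morFib, applyInf_morXi_fixedPoint]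
  · refine BeginsWith.isFactor (fixedPoint_morXi_spec 1).2 ?_
    fin_cases a
    exacts [⟨[], [1, 1], rfl⟩, ⟨[0], [1], rfl⟩]

theorem isSturmian_applyInf_morEta : IsSturmian (applyInf morEta (fixedPoint morXi 0)) := by
  rw [← morD_morD, ← applyInf_applyInf morD_ne_nil morD_ne_nil]
  exact isSturmian_fixedPoint_morXi.applyInf_morD.applyInf_morD

theorem add_sum_factorAt_firstDiff (w : ℕ → Fin 2) (n : ℕ) :
    w 0 + (factorAt (firstDiff w) 0 n).sum = w n := by
  induction n with
  | zero => simp [factorAt]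
  | succ n ih =>
    rw [factorAt_succ, List.sum_append, ← add_assoc, ih, zero_add, List.sum_singleton, firstDiff,
      ← add_assoc]
    generalize w n = a
    generalize w (n + 1) = b
    revert a b
    decide

/-- If arbitrarily long prefixes of the word of first differences occur again after an odd number
of letters `1`, the set of factors is closed under complementation. -/
theorem complClosed_of_beginsWith {w : ℕ → Fin 2} (h : ∀ n : ℕ, ∃ p l : List (Fin 2),
    n ≤ l.length ∧ p.sum = 1 ∧ BeginsWith (firstDiff w) l ∧ BeginsWith (firstDiff w) (p ++ l)) :
    ComplClosed w := by
  intro i n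
  obtain ⟨p, l, hl, hp, h1, h2⟩ := h (i + n)
  have h3 : BeginsWith (firstDiff w) p := h2.of_prefix (List.prefix_append _ _)
  rw [BeginsWith, List.length_append, factorAt_add, zero_add] at h2
  have h4 : SameAt (firstDiff w) 0 p.length l.length :=
    factorAt_eq_factorAt_iff.1 (h1.symm.trans (List.append_inj h2 (by rw [length_factorAt])).2)
  have h5 : w 0 ≠ w p.length := by
    rw [← add_sum_factorAt_firstDiff w p.length, ← h3, hp]
    generalize w 0 = a
    revert a
    decide
  refine ⟨p.length + i, ?_⟩
  have := (oppAt_of_firstDiff h4 h5).shift (k := i) (m := n) (by omega)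
  rwa [zero_add] at this

theorem sum_applyMor {φ : Fin 2 → List (Fin 2)} (hφ : ∀ a, (φ a).sum = a) (l : List (Fin 2)) :
    (applyMor φ l).sum = l.sum := by
  induction l with
  | nil => rfl
  | cons a l ih => rw [applyMor_cons, List.sum_append, hφ, ih, List.sum_cons]

theorem sum_iterate_morXi (m : ℕ) (l : List (Fin 2)) :
    ((applyMor morXi)^[m] l).sum = l.sum := by
  induction m with
  | zero => rfl
  | succ m ih => rw [Function.iterate_succ_apply', sum_applyMor (by decide), ih]

/-- The second iterate of `morXi` on `0` is `01101·0·1`. Since `01101` has an odd number of letters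
`1` and `morXi` preserves this parity, the prefix recurs as `complClosed_of_beginsWith` requires. -/
theorem beginsWith_iterate_morXi (m : ℕ) :
    BeginsWith (fixedPoint morXi 0) ((applyMor morXi)^[m] [0, 1, 1, 0, 1] ++
      (applyMor morXi)^[m] [0]) := by
  refine BeginsWith.of_prefix (fixedPoint_morXi_spec (m + 2)).2 ?_
  rw [Function.iterate_add_apply, ← iterate_applyMor_append]
  refine ⟨(applyMor morXi)^[m] [1], ?_⟩
  rw [← iterate_applyMor_append]
  rfl

theorem isCSRote_wordFH : IsCSRote wordFH := by
  refine isCSRote_of_isSturmian_firstDiff (firstDiff_wordFH ▸ isSturmian_fixedPoint_morXi)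
    (complClosed_of_beginsWith fun n => ⟨(applyMor morXi)^[n] [0, 1, 1, 0, 1],
      (applyMor morXi)^[n] [0], (fixedPoint_morXi_spec n).1.le, ?_, ?_, ?_⟩)
  · rw [sum_iterate_morXi]; rfl
  · rw [firstDiff_wordFH]
    exact (fixedPoint_morXi_spec n).2
  · rw [firstDiff_wordFH]
    exact beginsWith_iterate_morXi n

theorem isCSRote_wordFGH : IsCSRote wordFGH := by
  refine isCSRote_of_isSturmian_firstDiff (firstDiff_wordFGH ▸ isSturmian_applyInf_morEta)
    (complClosed_of_beginsWith fun n => ⟨applyMor morEta ((applyMor morXi)^[n] [0, 1, 1, 0, 1]),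
      applyMor morEta ((applyMor morXi)^[n] [0]), ?_, ?_, ?_, ?_⟩)
  · exact (fixedPoint_morXi_spec n).1.le.trans (le_length_applyMor morEta_ne_nil _)
  · rw [sum_applyMor (by decide), sum_iterate_morXi]; rfl
  · rw [firstDiff_wordFGH]
    exact BeginsWith.applyInf morEta_ne_nil (fixedPoint_morXi_spec n).2
  · rw [firstDiff_wordFGH, ← applyMor_append]
    exact (beginsWith_iterate_morXi n).applyInf morEta_ne_nil

end Main
end RichWords

theorem mainTheorem3 :
    (RichWords.InfRich RichWords.wordFH ∧ RichWords.InfRich RichWords.wordFGH) ∧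
    (RichWords.firstDiff RichWords.wordFH = RichWords.fixedPoint RichWords.morXi 0 ∧
      RichWords.firstDiff RichWords.wordFGH =
        RichWords.applyInf RichWords.morEta (RichWords.fixedPoint RichWords.morXi 0)) ∧
    (RichWords.IsSturmian (RichWords.fixedPoint RichWords.morXi 0) ∧
      RichWords.IsSturmian
        (RichWords.applyInf RichWords.morEta (RichWords.fixedPoint RichWords.morXi 0))) ∧
    (RichWords.IsCSRote RichWords.wordFH ∧ RichWords.IsCSRote RichWords.wordFGH) ∧
    (∀ w : ℕ → Fin 2, RichWords.IsCSRote w → RichWords.InfRich w) :=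
  ⟨⟨RichWords.isCSRote_wordFH.roteLike.infRich, RichWords.isCSRote_wordFGH.roteLike.infRich⟩,
    ⟨RichWords.firstDiff_wordFH, RichWords.firstDiff_wordFGH⟩,
    ⟨RichWords.isSturmian_fixedPoint_morXi, RichWords.isSturmian_applyInf_morEta⟩,
    ⟨RichWords.isCSRote_wordFH, RichWords.isCSRote_wordFGH⟩, fun _ h => h.roteLike.infRich⟩
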